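/- Let $\omega>0$ and $g>0$. There exists $w_0<\infty$ such that for every $w_1<\infty$ and every $\varepsilon>0$ there exist (a) a billiard table, i.e. a bounded connected open set $D\subset\mathbb{R}^2$ whose boundary is a simple closed regular $C^\infty$ curve, such that $D$ contains the closed unit disc and $\partial D\subset\{x\in\mathbb{R}^2: 1<|x|<1+\varepsilon\}$; and (b) a trajectory $x(t)$, $0\le t<T$, of a point particle in the table rotating counterclockwise about the origin with angular velocity $\omega$ (at time $t$ the table is $\mathcal R(\omega t)D$, where $\mathcal R(\theta)$ is the rotation by the angle $\theta$ about the origin), starting with energy $\|v(0+)\|^2=w_0$, such that the energy $\|v(t)\|^2$ exceeds $w_1$ at some time $t\in[0,T)$. Here $v=\dot x$ is the velocity in the inertial frame. A trajectory is continuous and has finitely many reflections in $(0,T)$. At all other times in $(0,T)$ the particle is in the interior of the rotating table and moves with $\dot v=(0,-g)$. Reflections take place at the boundary of the rotating table and are specular in the rotating frame: at a reflection time $t$ the velocity in that frame, $v^F=\mathcal R(-\omega t)\bigl(v-\omega\,\mathcal R(\pi/2)x\bigr)$, is replaced by its mirror image in the tangent line to $\partial D$ at the point $\mathcal R(-\omega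 t)x(t)\in\partial D$. -/

import Mathlib

/-- A planar billiard table with smooth boundary: `D` is a bounded connected open subset of the
plane (identified with `ℂ`) whose boundary is the simple closed regular `C^∞` curve `γ`. -/
structure IsSmoothBilliardTable (D : Set ℂ) (γ : ℝ → ℂ) : Prop where
  isOpen : IsOpen D
  isConnected : IsConnected D
  isBounded : Bornology.IsBounded D
  smooth : ContDiff ℝ (⊤ : ℕ∞) γ
  periodic : Function.Periodic γ (2 * Real.pi)
  injOn : Set.InjOn γ (Set.Ico 0 (2 * Real.pi))
  deriv_ne_zero : ∀ θ, deriv γ θ ≠ 0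
  frontier_eq : frontier D = Set.range γ

/-- The position, in the frame rotating counterclockwise about the origin with angular velocity
`ω`, of a particle which at time `t` is at the point `x t` of the inertial frame:
`x^F(t) = R(-ωt) x(t)`. -/
noncomputable def rotatingPosition (ω : ℝ) (x : ℝ → ℂ) (t : ℝ) : ℂ :=
  Complex.exp (-((ω * t : ℝ) : ℂ) * Complex.I) * x t

/-- The velocity in the rotating frame of a particle with inertial position `x t` and inertial
velocity `v t`: `v^F(t) = R(-ωt) (v(t) - ω R(π/2) x(t))`. -/
noncomputable def rotatingVelocity (ω : ℝ) (x v : ℝ → ℂ) (t : ℝ) : ℂ :=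
  Complex.exp (-((ω * t : ℝ) : ℂ) * Complex.I) * (v t - (ω : ℂ) * Complex.I * x t)

/-- `x` is the inertial position and `v` the (right-continuous) inertial velocity, during the time
interval `[0, T)`, of a point particle that moves in the table `D` with boundary `γ`, under the
constant downward gravitational acceleration `g`. The table rotates counterclockwise about the
origin with angular velocity `ω`. There are finitely many reflections, at the times in
`S ⊆ (0, T)`, and they are specular in the frame of reference that rotates with the table. -/
structure IsSpecularTrajectory (ω g : ℝ) (D : Set ℂ) (γ : ℝ → ℂ) (T : ℝ) (S : Finset ℝ)
    (x v : ℝ → ℂ) : Prop where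
  reflection_times : ∀ t ∈ S, t ∈ Set.Ioo 0 T
  continuousOn : ContinuousOn x (Set.Ico 0 T)
  /-- Between reflections the particle is inside the (rotating) table. -/
  mem_table : ∀ t ∈ Set.Ioo 0 T, t ∉ S → rotatingPosition ω x t ∈ D
  /-- Free flight at all times that are not reflection times. -/
  free_flight : ∀ t ∈ Set.Ioo 0 T, t ∉ S →
    HasDerivAt x (v t) t ∧ HasDerivAt v (-(g : ℂ) * Complex.I) t
  /-- At time `0` and at reflection times, `v` is the velocity just after. -/
  right_flight : ∀ t ∈ Set.Ico 0 T,
    HasDerivWithinAt x (v t) (Set.Ici t) t ∧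
      HasDerivWithinAt v (-(g : ℂ) * Complex.I) (Set.Ici t) t
  /-- At a reflection time the particle is at a boundary point of the table, and its outgoing
  velocity in the rotating frame is the mirror image of its incoming velocity in that frame in the
  tangent line to the boundary of the table. -/
  specular : ∀ t ∈ S, ∃ θ : ℝ, rotatingPosition ω x t = γ θ ∧
    ∃ u : ℂ, Filter.Tendsto (rotatingVelocity ω x v) (nhdsWithin t (Set.Iio t)) (nhds u) ∧
      rotatingVelocity ω x v t = (Submodule.span ℝ {deriv γ θ}).reflection u

/-! The table is a disc of radius `R` slightly larger than 1, deformed by arbitrarily small bumps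
that tilt its boundary at finitely many points. A reflection fixes the outgoing speed in the
rotating frame, but the tilt of the mirror turns an outward incoming velocity into any inward
velocity of that speed.

The energy comes from the torque of gravity. Reflections preserve `jacobiEnergy`, the energy minus
`ω` times the angular momentum, and in free flight it changes at the rate `ω * g` times the
horizontal coordinate. A particle whose flights all begin and end in the right half plane of the
inertial frame therefore gains at every flight (`jacobiEnergy_next_ge`). If its speed stayed
bounded, flights with displacement at least 1 would have durations bounded below, so the Jacobi
energy would grow linearly in the number of flights; but it is bounded when positions and velocities
are bounded (`exists_lt_sq_norm_vel`).

Such flights exist because a target fixed in the table can be hit at the speed forced by the last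
reflection, by the intermediate value theorem in the duration (`exists_flight_to_arc`). Infinitely
many targets are available, so no point of the table is hit twice. The finitely many mirrors needed
can then be tilted independently, by bumps too small to meet the path elsewhere (`exists_table`).
All bounds are uniform in `1 ≤ R ≤ 2`, so the initial speed depends only on `ω` and `g`. -/

/-! ### Star-shaped tables given by a radial function -/

section RadialTables
open Complex ComplexConjugate Filter Topology Set

/-- The star-shaped domain with radial function `F`, a function of the direction. -/
def radialDomain (F : ℂ → ℝ) : Set ℂ := {z | ‖z‖ < F (z / ‖z‖)}

/-- The boundary curve, in polar coordinates, of the domain with radial function `F`. -/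
noncomputable def radialCurve (F : ℂ → ℝ) (θ : ℝ) : ℂ := (F (exp (θ * I)) : ℂ) * exp (θ * I)

theorem hasDerivAt_exp_mul_I (θ : ℝ) :
    HasDerivAt (fun θ : ℝ => exp (θ * I)) (exp (θ * I) * I) θ := by
  have h : HasDerivAt (fun z : ℂ => exp (z * I)) (exp (θ * I) * (1 * I)) θ :=
    ((hasDerivAt_id (θ : ℂ)).mul_const I).cexp
  simpa using h.comp_ofReal

theorem hasDerivAt_radialCurve {F : ℂ → ℝ} {θ r' : ℝ}
    (h : HasDerivAt (fun θ : ℝ => F (exp (θ * I))) r' θ) :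
    HasDerivAt (radialCurve F) ((r' + F (exp (θ * I)) * I) * exp (θ * I)) θ := by
  have := h.ofReal_comp.mul (hasDerivAt_exp_mul_I θ)
  refine this.congr_deriv ?_
  ring

theorem exp_mul_I_div_norm {r θ : ℝ} (hr : 0 < r) :
    ((r : ℂ) * exp (θ * I)) / (‖(r : ℂ) * exp (θ * I)‖ : ℂ) = exp (θ * I) := by
  have : (r : ℂ) ≠ 0 := by exact_mod_cast hr.ne'
  rw [norm_mul, norm_exp_ofReal_mul_I, norm_real, Real.norm_of_nonneg hr.le]
  field_simp

theorem exp_mul_I_injective {a b : ℝ} (h : exp (a * I) = exp (b * I))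
    (hab : |a - b| < 2 * Real.pi) : a = b := by
  rw [exp_eq_exp_iff_exists_int] at h
  obtain ⟨n, hn⟩ := h
  have h2 : a = b + n * (2 * Real.pi) := by
    have h3 := congrArg Complex.im hn
    simpa using h3
  have hpi := Real.pi_pos
  rw [abs_lt] at hab
  have h3 : n = 0 := by
    have h4 : (n : ℝ) < 1 := by nlinarith
    have h5 : (-1 : ℝ) < n := by nlinarith
    have h6 : n < 1 := by exact_mod_cast h4
    have h7 : -1 < n := by exact_mod_cast h5
    omega
  simpa [h3] using h2

theorem norm_radialCurve {F : ℂ → ℝ} (hlo : ∀ z, 1 < F z) (θ : ℝ) :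
    ‖radialCurve F θ‖ = F (exp (θ * I)) := by
  rw [radialCurve, norm_mul, norm_exp_ofReal_mul_I, norm_real, mul_one,
    Real.norm_of_nonneg (zero_lt_one.trans (hlo _)).le]

theorem contDiff_comp_exp_mul_I {F : ℂ → ℝ} (hF : ContDiff ℝ (⊤ : ℕ∞) F) :
    ContDiff ℝ (⊤ : ℕ∞) (fun θ : ℝ => F (exp (θ * I))) :=
  hF.comp ((ofRealCLM.contDiff.mul contDiff_const).cexp)

theorem smul_mem_radialDomain {F : ℂ → ℝ} (hlo : ∀ z, 1 < F z) {z : ℂ} {a : ℝ} (ha : 0 ≤ a)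
    (h : a * ‖z‖ < F (z / ‖z‖)) : a • z ∈ radialDomain F := by
  simp only [radialDomain, mem_ofPred_eq]
  rcases eq_or_ne (a • z) 0 with h0 | h0
  · rw [h0, norm_zero]; exact zero_lt_one.trans (hlo _)
  · have ha' : (a : ℂ) ≠ 0 := by
      rintro h'; apply h0; rw [real_smul, h', zero_mul]
    have : (a • z) / (‖a • z‖ : ℂ) = z / ‖z‖ := by
      rw [norm_smul, Real.norm_of_nonneg ha, real_smul, ofReal_mul, mul_div_mul_left _ _ ha']
    rw [this, norm_smul, Real.norm_of_nonneg ha]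
    exact h

theorem continuousOn_comp_div_norm {F : ℂ → ℝ} (hF : Continuous F) :
    ContinuousOn (fun z : ℂ => ‖z‖ - F (z / ‖z‖)) {0}ᶜ := by
  refine continuous_norm.continuousOn.sub (hF.comp_continuousOn ?_)
  refine continuousOn_id.div (continuous_ofReal.comp continuous_norm).continuousOn ?_
  intro z hz
  simpa using hz

theorem isOpen_radialDomain {F : ℂ → ℝ} (hF : Continuous F) (hlo : ∀ z, 1 < F z) :
    IsOpen (radialDomain F) := by
  have h1 := (continuousOn_comp_div_norm hF).isOpen_inter_preimage isOpen_compl_singleton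
    (isOpen_Iio (a := (0 : ℝ)))
  -- The direction `z / ‖z‖` is discontinuous at the origin; the unit ball covers that point because
  -- `F > 1`.
  convert h1.union (Metric.isOpen_ball (x := (0 : ℂ)) (ε := 1)) using 1
  ext z
  simp only [radialDomain, mem_ofPred_eq, mem_union, mem_inter_iff, mem_compl_iff,
    mem_singleton_iff, mem_preimage, mem_Iio, Metric.mem_ball, dist_zero_right, sub_neg]
  constructor
  · intro h
    rcases eq_or_ne z 0 with rfl | h0
    · right; simp
    · exact Or.inl ⟨h0, h⟩
  · rintro (h | h)
    · exact h.2
    · exact h.trans (hlo _)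

/-- Away from the origin `‖z‖ - F (z / ‖z‖)` is continuous, so it vanishes at frontier points.
Conversely, points of the curve are approached from inside along their rays. -/
theorem frontier_radialDomain {F : ℂ → ℝ} (hF : Continuous F) (hlo : ∀ z, 1 < F z) :
    frontier (radialDomain F) = range (radialCurve F) := by
  rw [(isOpen_radialDomain hF hlo).frontier_eq]
  ext z
  constructor
  · rintro ⟨hz, hz'⟩
    have hle : F (z / ‖z‖) ≤ ‖z‖ := not_lt.mp hz'
    have h1 := (continuousOn_comp_div_norm hF).isOpen_inter_preimage isOpen_compl_singleton
      (isOpen_Ioi (a := (0 : ℝ)))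
    have h0 : z ≠ 0 := by
      rintro rfl
      have := hlo ((0 : ℂ) / ‖(0 : ℂ)‖)
      rw [norm_zero] at hle this
      linarith
    have heq : ‖z‖ = F (z / ‖z‖) := by
      refine le_antisymm ?_ hle
      by_contra! hlt
      obtain ⟨y, hy1, hy2⟩ := mem_closure_iff.mp hz _ h1 ⟨h0, by simpa using hlt⟩
      have h3 : F (y / ‖y‖) < ‖y‖ := by simpa using hy1.2
      exact lt_asymm h3 hy2
    have hexp : z / ‖z‖ = exp (arg z * I) := by
      have h2 := norm_mul_exp_arg_mul_I z
      have h3 : (‖z‖ : ℂ) ≠ 0 := by simpa using h0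
      rw [div_eq_iff h3, mul_comm, h2]
    refine ⟨arg z, ?_⟩
    rw [radialCurve, ← hexp, ← heq, hexp, norm_mul_exp_arg_mul_I]
  · rintro ⟨θ, rfl⟩
    have hpos : 0 < F (exp (θ * I)) := zero_lt_one.trans (hlo _)
    have hdir : radialCurve F θ / ‖radialCurve F θ‖ = exp (θ * I) := exp_mul_I_div_norm hpos
    constructor
    · have hlim : Tendsto (fun a : ℝ => a • radialCurve F θ) (𝓝[<] 1) (𝓝 (radialCurve F θ)) := by
        have : Tendsto (fun a : ℝ => a • radialCurve F θ) (𝓝 1) (𝓝 ((1 : ℝ) • radialCurve F θ)) :=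
          (continuous_id.smul continuous_const).tendsto 1
        rw [one_smul] at this
        exact this.mono_left nhdsWithin_le_nhds
      refine mem_closure_of_tendsto hlim ?_
      have : Ioo (0 : ℝ) 1 ∈ 𝓝[<] (1 : ℝ) := Ioo_mem_nhdsLT zero_lt_one
      filter_upwards [this] with a ha
      refine smul_mem_radialDomain hlo ha.1.le ?_
      rw [hdir, norm_radialCurve hlo]
      nlinarith [ha.2]
    · rw [radialDomain, mem_ofPred_eq, not_lt, hdir, norm_radialCurve hlo]

theorem isSmoothBilliardTable_radial {F : ℂ → ℝ} {ε : ℝ} (hF : ContDiff ℝ (⊤ : ℕ∞) F)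
    (hlo : ∀ z, 1 < F z) (hup : ∀ z, F z < 1 + ε) :
    IsSmoothBilliardTable (radialDomain F) (radialCurve F) where
  isOpen := isOpen_radialDomain hF.continuous hlo
  isConnected := by
    have h0 : (0 : ℂ) ∈ radialDomain F := by
      simp only [radialDomain, mem_ofPred_eq, norm_zero]
      exact zero_lt_one.trans (hlo _)
    have : StarConvex ℝ 0 (radialDomain F) := by
      rw [starConvex_zero_iff]
      intro z hz a ha0 ha1
      refine smul_mem_radialDomain hlo ha0 (lt_of_le_of_lt ?_ hz)
      exact mul_le_of_le_one_left (norm_nonneg z) ha1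
    exact (this.isPathConnected h0).isConnected
  isBounded := by
    refine (Metric.isBounded_ball (x := (0 : ℂ)) (r := 1 + ε)).subset fun z hz => ?_
    rw [mem_ball_zero_iff]
    exact lt_trans hz (hup _)
  smooth := (ofRealCLM.contDiff.comp (contDiff_comp_exp_mul_I hF)).mul
    ((ofRealCLM.contDiff.mul contDiff_const).cexp)
  periodic := by
    intro θ
    have : exp (((θ + 2 * Real.pi : ℝ) : ℂ) * I) = exp (θ * I) := by
      rw [exp_eq_exp_iff_exists_int]
      exact ⟨1, by push_cast; ring⟩
    simp only [radialCurve, this]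
  injOn := by
    intro a ha b hb hab
    have h1 : exp (a * I) = exp (b * I) := by
      rw [← exp_mul_I_div_norm (zero_lt_one.trans (hlo (exp (a * I)))),
        ← exp_mul_I_div_norm (θ := b) (zero_lt_one.trans (hlo (exp (b * I))))]
      change radialCurve F a / ‖radialCurve F a‖ = radialCurve F b / ‖radialCurve F b‖
      rw [hab]
    refine exp_mul_I_injective h1 ?_
    rw [abs_lt]
    constructor <;> linarith [ha.1, ha.2, hb.1, hb.2]
  deriv_ne_zero := by
    intro θ
    have hd : DifferentiableAt ℝ (fun θ : ℝ => F (exp (θ * I))) θ :=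
      (contDiff_comp_exp_mul_I hF).differentiable (by simp) θ
    rw [(hasDerivAt_radialCurve hd.hasDerivAt).deriv]
    refine mul_ne_zero (fun h => ?_) (exp_ne_zero _)
    have h1 := congrArg Complex.im h
    simp at h1
    linarith [hlo (exp (θ * I))]
  frontier_eq := frontier_radialDomain hF.continuous hlo

theorem closedBall_subset_radialDomain {F : ℂ → ℝ} (hlo : ∀ z, 1 < F z) :
    Metric.closedBall 0 1 ⊆ radialDomain F := by
  intro z hz
  rw [mem_closedBall_zero_iff] at hz
  exact hz.trans_lt (hlo _)

theorem frontier_radialDomain_subset {F : ℂ → ℝ} {ε : ℝ} (hF : Continuous F)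
    (hlo : ∀ z, 1 < F z) (hup : ∀ z, F z < 1 + ε) :
    frontier (radialDomain F) ⊆ {z : ℂ | 1 < ‖z‖ ∧ ‖z‖ < 1 + ε} := by
  rw [frontier_radialDomain hF hlo]
  rintro _ ⟨θ, rfl⟩
  rw [mem_ofPred_eq, norm_radialCurve hlo]
  exact ⟨hlo _, hup _⟩

/-- A smooth perturbation of the constant `R`, of size `O(η)`, that has prescribed slopes at
finitely many points of the unit circle. -/
theorem exists_radial_function {ι : Type*} (S : Finset ι) (e : ι → ℂ) (s : ι → ℝ) (R : ℝ)
    {η m : ℝ} (hη : 0 < η) (hηm : η ≤ m) (he : ∀ i ∈ S, ‖e i‖ = 1)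
    (hsep : ∀ i ∈ S, ∀ j ∈ S, i ≠ j → 2 * m ≤ dist (e i) (e j)) :
    ∃ F : ℂ → ℝ, ContDiff ℝ (⊤ : ℕ∞) F ∧ (∀ z, |F z - R| ≤ η * ∑ i ∈ S, |s i|) ∧
      (∀ i ∈ S, ∀ᶠ z in 𝓝 (e i), F z = R + s i * (z * conj (e i)).im) ∧
      ∀ i ∈ S, ∀ z, dist z (e i) < m → R + min 0 (s i * (z * conj (e i)).im) ≤ F z := by
  classical
  -- The supports have radius `η ≤ m` and the centres are at least `2 * m` apart, so within `m` of
  -- `e i` only the `i`-th bump is felt.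
  let f : ∀ i, ContDiffBump (e i) := fun i => ⟨η / 2, η, by positivity, by linarith⟩
  -- For unit vectors, `(z * conj (e i)).im` is the sine of the angle from `e i` to `z`, so its
  -- angular derivative at `e i` is 1.
  let G : ι → ℂ → ℝ := fun i z => s i * (z * conj (e i)).im * f i z
  have hother : ∀ i ∈ S, ∀ z, dist z (e i) < m → ∑ j ∈ S, G j z = G i z := by
    intro i hi z hz
    refine Finset.sum_eq_single_of_mem i hi fun j hj hji => ?_
    have h1 := hsep i hi j hj hji.symm
    have h2 : η ≤ dist z (e j) := by
      have := dist_triangle_left (e i) (e j) z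
      linarith
    simp only [G, (f j).zero_of_le_dist h2, mul_zero]
  refine ⟨fun z => R + ∑ i ∈ S, G i z, ?_, ?_, ?_, ?_⟩
  · refine contDiff_const.add (ContDiff.sum fun i _ => ?_)
    refine (contDiff_const.mul ?_).mul (f i).contDiff
    exact imCLM.contDiff.comp (contDiff_id.mul contDiff_const)
  · intro z
    rw [add_sub_cancel_left, Finset.mul_sum]
    refine (Finset.abs_sum_le_sum_abs _ _).trans (Finset.sum_le_sum fun i hi => ?_)
    rcases le_or_gt η (dist z (e i)) with h | h
    · simp only [G, (f i).zero_of_le_dist h, mul_zero, abs_zero]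
      positivity
    · have h1 : |(z * conj (e i)).im| ≤ η := by
        have h2 : (z * conj (e i)).im = ((z - e i) * conj (e i)).im := by
          simp only [mul_im, conj_im, conj_re, sub_re, sub_im]; ring
        rw [h2]
        refine (abs_im_le_norm _).trans ?_
        rw [norm_mul, norm_conj, he i hi, mul_one, ← dist_eq_norm]
        exact h.le
      have h3 : |f i z| ≤ 1 := by
        rw [abs_of_nonneg (f i).nonneg]; exact (f i).le_one
      simp only [G, abs_mul]
      calc |s i| * |(z * conj (e i)).im| * |f i z| ≤ |s i| * η * 1 := by gcongr
        _ = η * |s i| := by ring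
  · intro i hi
    have hm : 0 < m := hη.trans_le hηm
    filter_upwards [(f i).eventuallyEq_one, Metric.ball_mem_nhds (e i) hm] with z h1 h2
    rw [hother i hi z h2]
    simp only [G, h1, Pi.one_apply, mul_one]
  · intro i hi z hz
    simp only [hother i hi z hz]
    have h0 := (f i).nonneg (x := z)
    have h1 := (f i).le_one (x := z)
    simp only [G]
    set y := s i * (z * conj (e i)).im
    gcongr
    rcases le_total 0 y with h | h
    · rw [min_eq_left h]; positivity
    · rw [min_eq_right h]; nlinarith

end RadialTables
-- Mirrors with prescribed incoming and outgoing velocities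
section SpecularTables
open Complex ComplexConjugate Filter Topology Set

theorem eventually_neg_of_hasDerivWithinAt_Ici {f : ℝ → ℝ} {f' t : ℝ}
    (h : HasDerivWithinAt f f' (Ici t) t) (h0 : f t = 0) (hf' : f' < 0) :
    ∀ᶠ r in 𝓝[>] t, f r < 0 := by
  have h1 := (hasDerivWithinAt_iff_tendsto_slope' (by simp)).mp h.Ioi_of_Ici
  filter_upwards [h1.eventually_lt_const hf', self_mem_nhdsWithin] with r hr hr'
  rw [slope_def_field, h0, sub_zero] at hr
  have h2 : 0 < r - t := sub_pos.mpr hr'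
  by_contra! h3
  exact absurd hr (not_lt.mpr (div_nonneg h3 h2.le))

theorem eventually_neg_of_hasDerivWithinAt_Iic {f : ℝ → ℝ} {f' t : ℝ}
    (h : HasDerivWithinAt f f' (Iic t) t) (h0 : f t = 0) (hf' : 0 < f') :
    ∀ᶠ r in 𝓝[<] t, f r < 0 := by
  have h1 := (hasDerivWithinAt_iff_tendsto_slope' (by simp)).mp h.Iio_of_Iic
  filter_upwards [h1.eventually_const_lt hf', self_mem_nhdsWithin] with r hr hr'
  rw [slope_def_field, h0, sub_zero] at hr
  have h2 : r - t < 0 := sub_neg.mpr hr'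
  by_contra! h3
  exact absurd hr (not_lt.mpr (div_nonpos_of_nonneg_of_nonpos h3 h2.le))

/-- The signed quantity that is negative below the graph, in polar coordinates, of the radial
function `R + s * sin (θ - θ₀)`. -/
theorem hasDerivWithinAt_radial_defect {z : ℝ → ℂ} {w e : ℂ} {t R s : ℝ} {A : Set ℝ} (hR : 0 < R)
    (he : ‖e‖ = 1) (hzt : z t = R * e) (hz : HasDerivWithinAt z w A t) :
    -- This is `‖z‖ * (‖z‖ - R - s * sin (θ - θ₀))`: multiplying by the norm avoids dividing by it,
    -- and the square root of the squared norm is convenient to differentiate.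
    HasDerivWithinAt (fun r => ‖z r‖ ^ 2 - R * √(‖z r‖ ^ 2) - s * (z r * conj e).im)
      (R * (w * conj e).re - s * (w * conj e).im) A t := by
  have hN := hz.norm_sq
  have hnorm : ‖z t‖ ^ 2 = R ^ 2 := by
    rw [hzt, norm_mul, he, norm_real, Real.norm_of_nonneg hR.le, mul_one]
  have h1 := hN.sqrt (by rw [hnorm]; positivity)
  have h2 : HasDerivWithinAt (fun r => (z r * conj e).im) (w * conj e).im A t := by
    have h3 := (imCLM.hasFDerivAt (x := z t * conj e)).comp_hasDerivWithinAt t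
      (hz.mul_const (conj e))
    exact h3
  refine ((hN.sub (h1.const_mul R)).sub (h2.const_mul s)).congr_deriv ?_
  have hin : inner ℝ (z t) w = R * (w * conj e).re := by
    rw [hzt, Complex.inner]
    simp
    ring
  rw [hnorm, Real.sqrt_sq hR.le, hin]
  field_simp
  ring

/-- The slope of the mirror that turns the incoming velocity `u` into the outgoing velocity `w`
at a point in the direction `e` at distance `R` from the origin. -/
noncomputable def mirrorSlope (R : ℝ) (e u w : ℂ) : ℝ :=
  -(R * ((w - u) * conj e).im / ((w - u) * conj e).re)

/-- When `‖a‖ = ‖b‖` this reads `2⟨a, a - b⟩ = ‖a - b‖²`; it decides the signs in the next two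
lemmas. -/
theorem re_mul_conj_sub {a b : ℂ} :
    2 * (a.re * (a.re - b.re) + a.im * (a.im - b.im)) =
      ‖a‖ ^ 2 - ‖b‖ ^ 2 + ((a.re - b.re) ^ 2 + (a.im - b.im) ^ 2) := by
  rw [Complex.sq_norm, Complex.sq_norm, normSq_apply, normSq_apply]
  ring

/-- With `a`, `b` the velocities `w`, `u` seen from the direction `e`, the left side is `R * ⟨a, a -
b⟩ / (a - b).re`, whose numerator is positive and denominator negative. Hence the path leaves on the
inner side of the mirror's tangent line; `incoming_below_mirror` is the analogue before impact. -/
theorem outgoing_below_mirror {R : ℝ} {e u w : ℂ} (hR : 0 < R) (hn : ‖u‖ = ‖w‖)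
    (hu : 0 < (u * conj e).re) (hw : (w * conj e).re < 0) :
    R * (w * conj e).re - mirrorSlope R e u w * (w * conj e).im < 0 := by
  have hn' : ‖w * conj e‖ = ‖u * conj e‖ := by simp [hn]
  have key := re_mul_conj_sub (a := w * conj e) (b := u * conj e)
  rw [mirrorSlope, sub_mul, sub_re, sub_im]
  rw [hn'] at key
  set a := w * conj e
  set b := u * conj e
  have hneg : a.re - b.re < 0 := by linarith
  have : R * a.re - -(R * (a.im - b.im) / (a.re - b.re)) * a.im =
      R * (a.re * (a.re - b.re) + a.im * (a.im - b.im)) / (a.re - b.re) := by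
    field_simp [hneg.ne]
    ring
  rw [this]
  refine div_neg_of_pos_of_neg (mul_pos hR ?_) hneg
  nlinarith [sq_nonneg (a.im - b.im)]

theorem incoming_below_mirror {R : ℝ} {e u w : ℂ} (hR : 0 < R) (hn : ‖u‖ = ‖w‖)
    (hu : 0 < (u * conj e).re) (hw : (w * conj e).re < 0) :
    0 < R * (u * conj e).re - mirrorSlope R e u w * (u * conj e).im := by
  have hn' : ‖w * conj e‖ = ‖u * conj e‖ := by simp [hn]
  have key := re_mul_conj_sub (a := u * conj e) (b := w * conj e)
  rw [mirrorSlope, sub_mul, sub_re, sub_im]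
  rw [hn'] at key
  set a := w * conj e
  set b := u * conj e
  have hneg : a.re - b.re < 0 := by linarith
  have : R * b.re - -(R * (a.im - b.im) / (a.re - b.re)) * b.im =
      R * (-(b.re * (b.re - a.re) + b.im * (b.im - a.im))) / (a.re - b.re) := by
    field_simp [hneg.ne]
    ring
  rw [this]
  refine div_pos_of_neg_of_neg (mul_neg_of_pos_of_neg hR ?_) hneg
  nlinarith [sq_nonneg (b.im - a.im)]

/-- The slope makes the tangent `(s + R * I) * e` orthogonal to `w - u`. Equality of norms makes `u
+ w` orthogonal to `w - u`, hence parallel to the tangent. So `u` splits into a tangential part,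
which is kept, and a normal part, which changes sign. -/
theorem reflection_mirror {R : ℝ} {e u w : ℂ} (hR : 0 < R) (he : ‖e‖ = 1) (hn : ‖u‖ = ‖w‖)
    (hu : 0 < (u * conj e).re) (hw : (w * conj e).re < 0) :
    w = (Submodule.span ℝ {((mirrorSlope R e u w : ℂ) + R * I) * e}).reflection u := by
  have hee : e * conj e = 1 := by rw [mul_conj, normSq_eq_norm_sq, he]; simp
  have hn' : ‖w * conj e‖ ^ 2 = ‖u * conj e‖ ^ 2 := by simp [hn]
  rw [Complex.sq_norm, Complex.sq_norm, normSq_apply, normSq_apply] at hn'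
  have hue : u = (u * conj e) * e := by rw [mul_assoc, mul_comm (conj e), hee, mul_one]
  have hwe : w = (w * conj e) * e := by rw [mul_assoc, mul_comm (conj e), hee, mul_one]
  have hs : mirrorSlope R e u w =
      -(R * ((w * conj e).im - (u * conj e).im) / ((w * conj e).re - (u * conj e).re)) := by
    rw [mirrorSlope, sub_mul, sub_re, sub_im]
  set s := mirrorSlope R e u w
  set a := w * conj e
  set b := u * conj e
  have hneg : a.re - b.re < 0 := by linarith
  have hs' : s * (a.re - b.re) = -(R * (a.im - b.im)) := by
    rw [hs]; field_simp [hneg.ne]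
  have hmem : u + w ∈ Submodule.span ℝ {((s : ℂ) + R * I) * e} := by
    rw [Submodule.mem_span_singleton]
    refine ⟨(a.im + b.im) / R, ?_⟩
    rw [hue, hwe, ← add_mul, real_smul, ← mul_assoc]
    congr 1
    apply Complex.ext
    · simp
      field_simp
      have : (a.re - b.re) * ((a.im + b.im) * s - R * (b.re + a.re)) = 0 := by
        linear_combination (a.im + b.im) * hs' - R * hn'
      rcases mul_eq_zero.mp this with h | h
      · exact absurd h hneg.ne
      · linarith
    · simp
      field_simp
      ring
  have horth : u - w ∈ (Submodule.span ℝ {((s : ℂ) + R * I) * e})ᗮ := by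
    rw [Submodule.mem_orthogonal_singleton_iff_inner_right, Complex.inner, hue, hwe, ← sub_mul]
    have : (b - a) * e * conj (((s : ℂ) + R * I) * e) = (b - a) * conj ((s : ℂ) + R * I) := by
      rw [map_mul]; linear_combination (b - a) * conj ((s : ℂ) + R * I) * hee
    rw [this]
    simp
    linarith
  have h1 := Submodule.reflection_mem_subspace_eq_self hmem
  have h2 := Submodule.reflection_mem_subspace_orthogonalComplement_eq_neg horth
  have h3 : u = (1 / 2 : ℝ) • ((u + w) + (u - w)) := by
    rw [add_add_sub_cancel, ← two_smul ℝ u, smul_smul]; norm_num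
  have h4 := congrArg (Submodule.span ℝ {((s : ℂ) + R * I) * e}).reflection h3
  rw [map_smul, map_add, h1, h2, ← sub_eq_add_neg, add_sub_sub_cancel, ← two_smul ℝ w,
    smul_smul] at h4
  rw [h4]
  norm_num

theorem exists_separation {ι : Type*} [DecidableEq ι] (S : Finset ι) (e : ι → ℂ)
    (he : InjOn e S) :
    ∃ m > 0, ∀ i ∈ S, ∀ j ∈ S, i ≠ j → 2 * m ≤ dist (e i) (e j) := by
  have h : ∀ᶠ m : ℝ in 𝓝[>] 0, ∀ p ∈ S ×ˢ S, p.1 ≠ p.2 → 2 * m ≤ dist (e p.1) (e p.2) := by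
    rw [Filter.eventually_all_finset]
    intro p hp
    rw [Finset.mem_product] at hp
    by_cases hne : p.1 = p.2
    · simp [hne]
    have hpos : 0 < dist (e p.1) (e p.2) := dist_pos.mpr fun h => hne (he hp.1 hp.2 h)
    have : Ioo 0 (dist (e p.1) (e p.2) / 2) ∈ 𝓝[>] (0 : ℝ) := Ioo_mem_nhdsGT (by linarith)
    filter_upwards [this] with m hm _
    linarith [hm.2]
  obtain ⟨m, hm, hm0⟩ := (h.and self_mem_nhdsWithin).exists
  exact ⟨m, hm0, fun i hi j hj => hm (i, j) (Finset.mk_mem_product hi hj)⟩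

/-- For a curve `z` that stays in the open disc of radius `R`, except for finitely many visits to
distinct points of its boundary, there is a smooth billiard table that contains the curve and
reflects it in the way prescribed by its one-sided velocities `u`, `w`. -/
theorem exists_table {R ε T : ℝ} (hR : 1 < R) (hRε : R < 1 + ε) (S : Finset ℝ) (z : ℝ → ℂ)
    (u w : ℝ → ℂ) (hz : ContinuousOn z (Icc 0 T)) (hS : ∀ t ∈ S, t ∈ Ioo 0 T)
    (hin : ∀ t ∈ Icc 0 T, t ∉ S → ‖z t‖ < R) (hon : ∀ t ∈ S, ‖z t‖ = R) (hinj : InjOn z S)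
    (hl : ∀ t ∈ S, HasDerivWithinAt z (u t) (Iic t) t)
    (hr : ∀ t ∈ S, HasDerivWithinAt z (w t) (Ici t) t)
    (hn : ∀ t ∈ S, ‖u t‖ = ‖w t‖) (hu : ∀ t ∈ S, 0 < (u t * conj (z t)).re)
    (hw : ∀ t ∈ S, (w t * conj (z t)).re < 0) :
    ∃ (D : Set ℂ) (γ : ℝ → ℂ), IsSmoothBilliardTable D γ ∧ Metric.closedBall 0 1 ⊆ D ∧
      frontier D ⊆ {z : ℂ | 1 < ‖z‖ ∧ ‖z‖ < 1 + ε} ∧ (∀ t ∈ Icc 0 T, t ∉ S → z t ∈ D) ∧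
      ∀ t ∈ S, ∃ θ : ℝ, z t = γ θ ∧
        w t = (Submodule.span ℝ {deriv γ θ}).reflection (u t) := by
  have hR0 : 0 < R := by linarith
  have hRc : (R : ℂ) ≠ 0 := by exact_mod_cast hR0.ne'
  set e : ℝ → ℂ := fun t => z t / R with he_def
  set s : ℝ → ℝ := fun t => mirrorSlope R (e t) (u t) (w t)
  have hze : ∀ t, z t = R * e t := fun t => by simp only [he_def]; field_simp
  have he1 : ∀ t ∈ S, ‖e t‖ = 1 := by
    intro t ht
    simp only [he_def, norm_div, hon t ht, norm_real, Real.norm_of_nonneg hR0.le, div_self hR0.ne']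
  have heinj : InjOn e S := fun a ha b hb hab => hinj ha hb (by rw [hze a, hze b, hab])
  have hre : ∀ (v : ℂ) t, (v * conj (z t)).re = R * (v * conj (e t)).re := by
    intro v t
    rw [hze t, map_mul, conj_ofReal, ← mul_assoc, mul_comm v, mul_assoc, re_ofReal_mul]
  have hu' : ∀ t ∈ S, 0 < (u t * conj (e t)).re := fun t ht =>
    (mul_pos_iff_of_pos_left hR0).mp (hre (u t) t ▸ hu t ht)
  have hw' : ∀ t ∈ S, (w t * conj (e t)).re < 0 := fun t ht => by
    have h1 := hw t ht
    rw [hre] at h1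
    by_contra! h2
    exact absurd h1 (not_lt.mpr (by positivity))
  obtain ⟨m, hm0, hm⟩ := exists_separation S e heinj
  have hat : ∀ t ∈ S, z t / ‖z t‖ = e t := fun t ht => by rw [hon t ht]
  -- the curve near a reflection
  have hlocal : ∀ i ∈ S, ∀ᶠ t in 𝓝 i, dist (z t / ‖z t‖) (e i) < m ∧
      (t ≠ i → ‖z t‖ < R → ‖z t‖ < R + min 0 (s i * (z t / ‖z t‖ * conj (e i)).im)) := by
    intro i hi
    have hnhds : Icc 0 T ∈ 𝓝 i := Icc_mem_nhds (hS i hi).1 (hS i hi).2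
    have hcont : ContinuousAt z i := hz.continuousAt hnhds
    have hi0 : ‖z i‖ ≠ 0 := by rw [hon i hi]; exact hR0.ne'
    refine Eventually.and ?_ ?_
    · have h1 : ContinuousAt (fun t => z t / (‖z t‖ : ℂ)) i :=
        hcont.div (continuous_ofReal.continuousAt.comp hcont.norm) (by exact_mod_cast hi0)
      have h2 := h1.eventually (Metric.ball_mem_nhds _ hm0)
      simp only [hat i hi] at h2
      exact h2
    · have h0 : ‖z i‖ ^ 2 - R * √(‖z i‖ ^ 2) - s i * (z i * conj (e i)).im = 0 := by
        have : (z i * conj (e i)).im = 0 := by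
          rw [hze i, mul_assoc, mul_conj, ← ofReal_mul, ofReal_im]
        rw [this, Real.sqrt_sq (norm_nonneg _), hon i hi]
        ring
      have h1 := eventually_neg_of_hasDerivWithinAt_Ici
        (hasDerivWithinAt_radial_defect (s := s i) hR0 (he1 i hi) (hze i) (hr i hi)) h0
        (outgoing_below_mirror hR0 (hn i hi) (hu' i hi) (hw' i hi))
      have h2 := eventually_neg_of_hasDerivWithinAt_Iic
        (hasDerivWithinAt_radial_defect (s := s i) hR0 (he1 i hi) (hze i) (hl i hi)) h0
        (incoming_below_mirror hR0 (hn i hi) (hu' i hi) (hw' i hi))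
      have h3 : ∀ᶠ t in 𝓝[≠] i,
          ‖z t‖ ^ 2 - R * √(‖z t‖ ^ 2) - s i * (z t * conj (e i)).im < 0 := by
        rw [← Iio_union_Ioi, nhdsWithin_union]
        exact eventually_sup.mpr ⟨h2, h1⟩
      have h4 : ∀ᶠ t in 𝓝 i, ‖z t‖ ≠ 0 := hcont.norm.eventually_ne hi0
      filter_upwards [eventually_nhdsWithin_iff.mp h3, h4] with t ht ht0 hti htR
      have h5 := ht hti
      rw [Real.sqrt_sq (norm_nonneg _)] at h5
      have hpos : 0 < ‖z t‖ := lt_of_le_of_ne (norm_nonneg _) (Ne.symm ht0)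
      have h6 : (z t / ‖z t‖ * conj (e i)).im = (z t * conj (e i)).im / ‖z t‖ := by
        rw [div_mul_eq_mul_div, div_ofReal_im]
      -- The path must be below both the circle and the tilted graph, since the cut-off radial
      -- function lies above the lower of the two.
      rw [← sub_lt_iff_lt_add', lt_min_iff]
      refine ⟨by linarith, ?_⟩
      rw [h6, mul_div_assoc', lt_div_iff₀ hpos]
      nlinarith
  choose! U hU hUopen hUmem using fun i hi => eventually_nhds_iff.mp (hlocal i hi)
  -- the curve away from the reflections
  obtain ⟨δ, hδ0, hδ⟩ : ∃ δ > 0, ∀ t ∈ Icc 0 T, (∀ i ∈ S, t ∉ U i) → ‖z t‖ ≤ R - δ := by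
    -- By compactness, the path stays a definite distance `δ` below the circle off the
    -- neighbourhoods `U i`. A deformation smaller than `δ` cannot touch it there.
    have hK : IsCompact (Icc 0 T \ ⋃ i ∈ S, U i) :=
      isCompact_Icc.diff (isOpen_biUnion fun i hi => hUopen i hi)
    rcases (Icc 0 T \ ⋃ i ∈ S, U i).eq_empty_or_nonempty with h | h
    · refine ⟨1, one_pos, fun t ht ht' => ?_⟩
      have : t ∈ (∅ : Set ℝ) := h ▸ ⟨ht, by simpa using ht'⟩
      exact absurd this (notMem_empty t)
    · obtain ⟨t₀, ht₀, hmax⟩ := hK.exists_isMaxOn h (hz.norm.mono sdiff_subset)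
      have ht₀S : t₀ ∉ S := fun h => ht₀.2 (mem_biUnion h (hUmem t₀ h))
      refine ⟨R - ‖z t₀‖, sub_pos.mpr (hin t₀ ht₀.1 ht₀S), fun t ht ht' => ?_⟩
      rw [sub_sub_cancel]
      exact hmax ⟨ht, by simpa using ht'⟩
  set σ := ∑ i ∈ S, |s i|
  have hσ : 0 ≤ σ := Finset.sum_nonneg fun i _ => abs_nonneg _
  obtain ⟨η, hη0, hηm, hηb⟩ : ∃ η > 0, η ≤ m ∧ η * σ < min δ (min (R - 1) (1 + ε - R)) := by
    have hb : 0 < min δ (min (R - 1) (1 + ε - R)) :=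
      lt_min hδ0 (lt_min (by linarith) (by linarith))
    set b := min δ (min (R - 1) (1 + ε - R))
    -- The denominator is `σ + 1` because `σ` may vanish.
    refine ⟨min m (b / (σ + 1)), lt_min hm0 (by positivity), min_le_left _ _, ?_⟩
    calc min m (b / (σ + 1)) * σ ≤ b / (σ + 1) * σ := by gcongr; exact min_le_right _ _
      _ < b := by
        rw [div_mul_eq_mul_div, div_lt_iff₀ (by positivity)]
        nlinarith
  rw [lt_min_iff, lt_min_iff] at hηb
  obtain ⟨hb1, hb2, hb3⟩ := hηb
  obtain ⟨F, hF, hFb, hFe, hFm⟩ := exists_radial_function S e s R hη0 hηm he1 hm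
  have hlo : ∀ y, 1 < F y := fun y => by linarith [(abs_le.mp (hFb y)).1]
  have hup : ∀ y, F y < 1 + ε := fun y => by linarith [(abs_le.mp (hFb y)).2]
  refine ⟨radialDomain F, radialCurve F, isSmoothBilliardTable_radial hF hlo hup,
    closedBall_subset_radialDomain hlo, frontier_radialDomain_subset hF.continuous hlo hup, ?_, ?_⟩
  · intro t ht htS
    change ‖z t‖ < F (z t / ‖z t‖)
    by_cases h : ∃ i ∈ S, t ∈ U i
    · obtain ⟨i, hi, hti⟩ := h
      obtain ⟨h1, h2⟩ := hU i hi t hti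
      exact (h2 (fun h => htS (h ▸ hi)) (hin t ht htS)).trans_le (hFm i hi _ h1)
    · push Not at h
      linarith [hδ t ht h, (abs_le.mp (hFb (z t / ‖z t‖))).1]
  · intro t ht
    have hexp : exp (arg (e t) * I) = e t := by
      have := norm_mul_exp_arg_mul_I (e t)
      rwa [he1 t ht, ofReal_one, one_mul] at this
    have hee : e t * conj (e t) = 1 := by
      rw [mul_conj, normSq_eq_norm_sq, he1 t ht]; simp
    have hFt : F (e t) = R := by
      rw [(hFe t ht).self_of_nhds, hee]; simp
    refine ⟨arg (e t), ?_, ?_⟩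
    · rw [radialCurve, hexp, hFt, ← hze]
    · have hd : HasDerivAt (fun θ : ℝ => F (exp (θ * I))) (s t) (arg (e t)) := by
        have h1 := hasDerivAt_exp_mul_I (arg (e t))
        have h2 : HasDerivAt (fun θ : ℝ => (exp (θ * I) * conj (e t)).im) 1 (arg (e t)) := by
          have h3 := (imCLM.hasFDerivAt
            (x := exp (arg (e t) * I) * conj (e t))).comp_hasDerivAt (arg (e t))
            (h1.mul_const (conj (e t)))
          refine h3.congr_deriv ?_
          rw [hexp, mul_right_comm, hee]
          simp
        have h4 : HasDerivAt (fun θ : ℝ => R + s t * (exp (θ * I) * conj (e t)).im) (s t)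
            (arg (e t)) := by
          simpa using (h2.const_mul (s t)).const_add R
        refine h4.congr_of_eventuallyEq ?_
        have h5 := h1.continuousAt.tendsto
        rw [hexp] at h5
        exact h5.eventually (hFe t ht)
      rw [(hasDerivAt_radialCurve hd).deriv, hexp, hFt]
      exact reflection_mirror hR0 (he1 t ht) (hn t ht) (hu' t ht) (hw' t ht)

end SpecularTables
-- Ballistic flights and the growth of the Jacobi energy
section Flights
open Complex ComplexConjugate Filter Topology Set

/-- A ballistic flight: starting time, position and velocity, duration, and the set of points of
the rotating table at which some reflections, including the one that ends the flight, take place. -/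
structure Flight where
  time : ℝ
  pos : ℂ
  vel : ℂ
  dur : ℝ
  visited : Finset ℂ

namespace Flight

/-- The position at time `s` after the start. -/
noncomputable def posAt (g : ℝ) (f : Flight) (s : ℝ) : ℂ :=
  f.pos + f.vel * s - (g / 2 : ℝ) * I * (s : ℂ) ^ 2

theorem posAt_re (g : ℝ) (f : Flight) (s : ℝ) : (f.posAt g s).re = f.pos.re + f.vel.re * s := by
  simp [posAt, ← ofReal_pow]

theorem posAt_im (g : ℝ) (f : Flight) (s : ℝ) :
    (f.posAt g s).im = f.pos.im + f.vel.im * s - g / 2 * s ^ 2 := by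
  simp [posAt, ← ofReal_pow]

/-- The velocity at time `s` after the start. -/
noncomputable def velAt (g : ℝ) (f : Flight) (s : ℝ) : ℂ := f.vel - g * I * s

/-- The landing point in the frame that rotates with the table. -/
noncomputable def landing (ω g : ℝ) (f : Flight) : ℂ :=
  exp (-((ω * (f.time + f.dur) : ℝ) : ℂ) * I) * f.posAt g f.dur

end Flight

/-- The energy minus `ω` times the angular momentum. It is preserved by reflections. -/
noncomputable def jacobiEnergy (ω g : ℝ) (p v : ℂ) : ℝ :=
  ‖v‖ ^ 2 / 2 + g * p.im - ω * (conj p * v).im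

/-- At a given point, the speed in the rotating frame and the Jacobi energy determine each other.
This gives invariance under reflections, and turns lower bounds on the Jacobi energy into lower
bounds on the speed. -/
theorem sq_norm_sub_eq_jacobiEnergy (ω g : ℝ) (p v : ℂ) :
    ‖v - ω * I * p‖ ^ 2 = 2 * jacobiEnergy ω g p v - 2 * g * p.im + ω ^ 2 * ‖p‖ ^ 2 := by
  rw [jacobiEnergy, Complex.sq_norm, Complex.sq_norm, Complex.sq_norm]
  simp only [normSq_apply]
  simp
  ring

/-- Gravity exerts the torque `-g * re`, so the rate of change is `ω * g * re`. The horizontal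
coordinate is affine in time, so the trapezoidal rule integrates it exactly. -/
theorem jacobiEnergy_flight (ω g : ℝ) (f : Flight) (s : ℝ) :
    jacobiEnergy ω g (f.posAt g s) (f.velAt g s) =
      jacobiEnergy ω g f.pos f.vel + ω * g * s * (f.pos.re + (f.posAt g s).re) / 2 := by
  simp only [jacobiEnergy, Complex.sq_norm, normSq_apply, mul_im, conj_re, conj_im,
    Flight.posAt_re, Flight.posAt_im, Flight.velAt]
  simp
  ring

/-- A bound for the durations of the flights used. -/
noncomputable def maxDuration (ω g : ℝ) : ℝ := 1 / (4 * (1 + g + ω))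

/-- A bound for the speeds, in the rotating frame, of the flights used. -/
noncomputable def minSpeed (ω g : ℝ) : ℝ := 4 / maxDuration ω g + g + 2 * ω

theorem maxDuration_pos {ω g : ℝ} (hω : 0 < ω) (hg : 0 < g) : 0 < maxDuration ω g := by
  rw [maxDuration]; positivity

/-- During a flight the table turns by at most `1 / 4 < π / 12`, and gravity changes the velocity by
at most `1 / 4`. -/
theorem maxDuration_mul {ω g : ℝ} (hω : 0 < ω) (hg : 0 < g) :
    maxDuration ω g + g * maxDuration ω g + ω * maxDuration ω g = 1 / 4 := by
  have : 1 + g + ω ≠ 0 := by positivity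
  rw [maxDuration]
  field_simp

/-- The term 4 bounds the diameter `2 * R`; the others absorb the fall and the motion of the table
during the flight. -/
theorem minSpeed_mul {ω g : ℝ} (hω : 0 < ω) (hg : 0 < g) :
    minSpeed ω g * maxDuration ω g =
      4 + g * maxDuration ω g + 2 * ω * maxDuration ω g := by
  have := (maxDuration_pos hω hg).ne'
  rw [minSpeed]
  field_simp

/-- There is a flight of prescribed initial speed, relative to `c`, from a point `p` of a disc to
an arc of the circle of radius `R` that avoids finitely many points of the rotating frame. -/
theorem exists_flight_to_arc {ω g R κ τ₁ β : ℝ} {p c : ℂ} (hω : 0 < ω) (hg : 0 < g) (hR : 0 < R)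
    (hτ₁ : 0 < τ₁) (hωτ : ω * τ₁ ≤ Real.pi / 12) (hp : ‖p‖ ≤ R)
    (hκ : 2 * R + g * τ₁ ^ 2 / 2 + ‖c‖ * τ₁ ≤ κ * τ₁)
    (hβ : ∀ α ∈ Icc β (β + Real.pi / 6), 1 ≤ ‖(R : ℂ) * exp (α * I) - p‖) (t : ℝ)
    (A : Finset ℂ) :
    ∃ τ ∈ Ioc 0 τ₁, ∃ α ∈ Icc β (β + Real.pi / 6),
      ‖(R : ℂ) * exp (α * I) - p + (g / 2 : ℝ) * I * (τ : ℂ) ^ 2 - c * τ‖ = κ * τ ∧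
      exp (-((ω * (t + τ) : ℝ) : ℂ) * I) * (R * exp (α * I)) ∉ A := by
  have hpi := Real.pi_pos
  -- The target angle `φ` is fixed in the rotating frame. It uses half of the arc's width `π / 6`;
  -- the other half leaves room for the rotation during the flight.
  have hinf : (Icc (β - ω * t) (β - ω * t + Real.pi / 12)).Infinite :=
    Icc_infinite (by linarith)
  have hinj : InjOn (fun φ : ℝ => (R : ℂ) * exp (φ * I))
      (Icc (β - ω * t) (β - ω * t + Real.pi / 12)) := by
    intro a ha b hb hab
    have hRc : (R : ℂ) ≠ 0 := by exact_mod_cast hR.ne'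
    refine exp_mul_I_injective (mul_left_cancel₀ hRc hab) ?_
    rw [abs_lt]
    constructor <;> linarith [ha.1, ha.2, hb.1, hb.2]
  obtain ⟨_, ⟨φ, hφ, rfl⟩, hA⟩ := (hinf.image hinj).exists_notMem_finset A
  let α : ℝ → ℝ := fun τ => φ + ω * (t + τ)
  have hα : ∀ τ ∈ Icc 0 τ₁, α τ ∈ Icc β (β + Real.pi / 6) := by
    intro τ hτ
    have h1 : 0 ≤ ω * τ := mul_nonneg hω.le hτ.1
    have h2 : ω * τ ≤ ω * τ₁ := mul_le_mul_of_nonneg_left hτ.2 hω.le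
    simp only [α]
    constructor <;> linarith [hφ.1, hφ.2]
  -- A zero `τ > 0` is a duration for which hitting the moving target requires exactly the speed `κ`
  -- relative to `c`. At 0 the target is at distance at least 1; at `τ₁` the speed `κ` is more than
  -- enough.
  let f : ℝ → ℝ := fun τ =>
    ‖(R : ℂ) * exp (α τ * I) - p + (g / 2 : ℝ) * I * (τ : ℂ) ^ 2 - c * τ‖ - κ * τ
  have hf : Continuous f := by
    simp only [f, α]
    fun_prop
  have hf0 : 0 < f 0 := by
    have := hβ _ (hα 0 ⟨le_rfl, hτ₁.le⟩)
    simp only [f, ofReal_zero, mul_zero, sub_zero]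
    simp only [ne_eq, OfNat.ofNat_ne_zero, not_false_eq_true, zero_pow, mul_zero, add_zero]
    linarith
  have hf1 : f τ₁ ≤ 0 := by
    have h1 : ‖(R : ℂ) * exp (α τ₁ * I)‖ = R := by
      rw [norm_mul, norm_exp_ofReal_mul_I, norm_real, Real.norm_of_nonneg hR.le, mul_one]
    have h2 : ‖((g / 2 : ℝ) : ℂ) * I * (τ₁ : ℂ) ^ 2‖ = g / 2 * τ₁ ^ 2 := by
      rw [norm_mul, norm_mul, norm_real, norm_I, norm_pow, norm_real, Real.norm_of_nonneg hτ₁.le,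
        Real.norm_of_nonneg (by positivity), mul_one]
    have h3 : ‖c * (τ₁ : ℂ)‖ = ‖c‖ * τ₁ := by
      rw [norm_mul, norm_real, Real.norm_of_nonneg hτ₁.le]
    have h4 := norm_sub_le ((R : ℂ) * exp (α τ₁ * I) - p + (g / 2 : ℝ) * I * (τ₁ : ℂ) ^ 2) (c * τ₁)
    have h5 := norm_add_le ((R : ℂ) * exp (α τ₁ * I) - p) ((g / 2 : ℝ) * I * (τ₁ : ℂ) ^ 2)
    have h6 := norm_sub_le ((R : ℂ) * exp (α τ₁ * I)) p
    simp only [f]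
    linarith
  obtain ⟨τ, hτ, hτ0⟩ := intermediate_value_Icc' hτ₁.le hf.continuousOn ⟨hf1, hf0.le⟩
  have hτpos : 0 < τ := by
    refine lt_of_le_of_ne hτ.1 ?_
    rintro rfl
    exact hf0.ne' hτ0
  refine ⟨τ, ⟨hτpos, hτ.2⟩, α τ, hα τ hτ, sub_eq_zero.mp hτ0, ?_⟩
  have : exp (-((ω * (t + τ) : ℝ) : ℂ) * I) * (R * exp (α τ * I)) = R * exp (φ * I) := by
    rw [mul_left_comm, ← Complex.exp_add]
    congr 2
    simp only [α]
    push_cast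
    ring
  rw [this]
  exact hA

theorem half_le_cos_sin {α : ℝ} (h1 : Real.pi / 6 ≤ α) (h2 : α ≤ Real.pi / 3) :
    1 / 2 ≤ Real.cos α ∧ 1 / 2 ≤ Real.sin α := by
  have hpi := Real.pi_pos
  constructor
  · rw [← Real.cos_pi_div_three]
    exact Real.cos_le_cos_of_nonneg_of_le_pi (by linarith) (by linarith) h2
  · rw [← Real.sin_pi_div_six]
    exact Real.sin_le_sin_of_le_of_le_pi_div_two (by linarith) (by linarith) h1

/-- The flights used: they go from the right half of the disc of radius `R` to a point in the right
half of its boundary that is not too close, in a short time. -/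
structure IsGoodFlight (ω g R : ℝ) (f : Flight) : Prop where
  dur_pos : 0 < f.dur
  dur_le : f.dur ≤ maxDuration ω g
  norm_pos : ‖f.pos‖ ≤ R
  re_pos : 1 / 2 ≤ f.pos.re
  norm_end : ‖f.posAt g f.dur‖ = R
  re_end : 1 / 2 ≤ (f.posAt g f.dur).re
  -- Being away from the horizontal axis lets the next flight cross it, with a height difference of
  -- at least 1.
  abs_im_end : 1 / 2 ≤ |(f.posAt g f.dur).im|
  dist_le : 1 ≤ ‖f.posAt g f.dur - f.pos‖
  -- The term `2 * g` pays for the potential energy at height at most 2.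
  jacobi_le : minSpeed ω g ^ 2 / 2 + 2 * g ≤ jacobiEnergy ω g f.pos f.vel
  landing_mem : f.landing ω g ∈ f.visited

/-- The target lies across the horizontal axis from `p`, still in the right half plane. Here `c` is
the velocity of the table at `p`, or 0 for the initial flight. -/
theorem exists_flight {ω g R κ : ℝ} {p c : ℂ} (hω : 0 < ω) (hg : 0 < g) (hR1 : 1 ≤ R)
    (hR2 : R ≤ 2) (hp : ‖p‖ ≤ R) (him : 1 / 2 ≤ |p.im|)
    (hc : ‖c‖ ≤ 2 * ω) (hκ : minSpeed ω g ≤ κ) (t : ℝ) (A : Finset ℂ) :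
    ∃ (τ : ℝ) (v q : ℂ), 0 < τ ∧ τ ≤ maxDuration ω g ∧
      q = p + v * τ - (g / 2 : ℝ) * I * (τ : ℂ) ^ 2 ∧ ‖v - c‖ = κ ∧ ‖q‖ = R ∧ 1 / 2 ≤ q.re ∧
      1 / 2 ≤ |q.im| ∧ 1 ≤ ‖q - p‖ ∧ exp (-((ω * (t + τ) : ℝ) : ℂ) * I) * q ∉ A := by
  have hτ₁ := maxDuration_pos hω hg
  have hmul := maxDuration_mul hω hg
  have hsp := minSpeed_mul hω hg
  set τ₁ := maxDuration ω g
  have hpi := Real.pi_gt_d2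
  have h1 : 0 < g * τ₁ := mul_pos hg hτ₁
  have h2 : 0 < ω * τ₁ := mul_pos hω hτ₁
  have hR : 0 < R := by linarith
  have hωτ : ω * τ₁ ≤ Real.pi / 12 := by linarith
  have hκ' : 2 * R + g * τ₁ ^ 2 / 2 + ‖c‖ * τ₁ ≤ κ * τ₁ := by
    have h3 : minSpeed ω g * τ₁ ≤ κ * τ₁ := mul_le_mul_of_nonneg_right hκ hτ₁.le
    have h4 : ‖c‖ * τ₁ ≤ 2 * ω * τ₁ := mul_le_mul_of_nonneg_right hc hτ₁.le
    nlinarith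
  have hexp : ∀ α : ℝ, ((R : ℂ) * exp (α * I)).re = R * Real.cos α ∧
      ((R : ℂ) * exp (α * I)).im = R * Real.sin α := fun α => by
    rw [re_ofReal_mul, im_ofReal_mul, exp_ofReal_mul_I_re, exp_ofReal_mul_I_im]
    exact ⟨rfl, rfl⟩
  -- the arc on the other side of the horizontal axis
  obtain ⟨β, hβ⟩ : ∃ β, ∀ α ∈ Icc β (β + Real.pi / 6), 1 / 2 ≤ Real.cos α ∧
      1 / 2 ≤ |Real.sin α| ∧ 1 / 2 + |R * Real.sin α| ≤ |R * Real.sin α - p.im| := by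
    rcases le_abs'.mp him with h | h
    · refine ⟨Real.pi / 6, fun α hα => ?_⟩
      obtain ⟨h3, h4⟩ := half_le_cos_sin hα.1 (by linarith [hα.2])
      have h5 : 0 ≤ R * Real.sin α := by positivity
      refine ⟨h3, h4.trans (le_abs_self _), ?_⟩
      rw [abs_of_nonneg h5]
      refine le_trans ?_ (le_abs_self _)
      linarith
    · refine ⟨-(Real.pi / 3), fun α hα => ?_⟩
      obtain ⟨h3, h4⟩ := half_le_cos_sin (α := -α) (by linarith [hα.2]) (by linarith [hα.1])
      rw [Real.cos_neg] at h3
      rw [Real.sin_neg] at h4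
      have h5 : R * Real.sin α ≤ 0 := mul_nonpos_of_nonneg_of_nonpos hR.le (by linarith)
      refine ⟨h3, by rw [← abs_neg]; exact h4.trans (le_abs_self _), ?_⟩
      rw [abs_of_nonpos h5]
      refine le_trans ?_ (neg_le_abs _)
      linarith
  have hfar : ∀ α ∈ Icc β (β + Real.pi / 6), 1 / 2 ≤ |((R : ℂ) * exp (α * I)).im| ∧
      1 ≤ ‖(R : ℂ) * exp (α * I) - p‖ := by
    intro α hα
    obtain ⟨-, h4, h5⟩ := hβ α hα
    have h6 : 1 / 2 ≤ |R * Real.sin α| := by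
      rw [abs_mul, abs_of_pos hR]; nlinarith
    rw [(hexp α).2]
    refine ⟨h6, le_trans ?_ (abs_im_le_norm _)⟩
    rw [sub_im, (hexp α).2]
    linarith
  obtain ⟨τ, hτ, α, hα, heq, hA⟩ := exists_flight_to_arc hω hg hR hτ₁ hωτ hp hκ'
    (fun α hα => (hfar α hα).2) t A
  have hτc : (τ : ℂ) ≠ 0 := by exact_mod_cast hτ.1.ne'
  refine ⟨τ, ((R : ℂ) * exp (α * I) - p + (g / 2 : ℝ) * I * (τ : ℂ) ^ 2) / τ, R * exp (α * I),
    hτ.1, hτ.2, ?_, ?_, ?_, ?_, (hfar α hα).1, (hfar α hα).2, hA⟩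
  · field_simp
    ring
  · have h3 : (((R : ℂ) * exp (α * I) - p + (g / 2 : ℝ) * I * (τ : ℂ) ^ 2) / τ - c) =
        ((R : ℂ) * exp (α * I) - p + (g / 2 : ℝ) * I * (τ : ℂ) ^ 2 - c * τ) / τ := by
      field_simp
    rw [h3, norm_div, heq, norm_real, Real.norm_of_nonneg hτ.1.le, mul_div_cancel_right₀ _ hτ.1.ne']
  · rw [norm_mul, norm_exp_ofReal_mul_I, norm_real, Real.norm_of_nonneg hR.le, mul_one]
  · rw [(hexp α).1]
    nlinarith [(hβ α hα).1]

/-- The flight `f'` follows `f` after a reflection at a point that was not visited before. -/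
structure IsNextFlight (ω g : ℝ) (f f' : Flight) : Prop where
  time_eq : f'.time = f.time + f.dur
  pos_eq : f'.pos = f.posAt g f.dur
  norm_eq : ‖f'.vel - ω * I * f'.pos‖ = ‖f.velAt g f.dur - ω * I * f'.pos‖
  visited_subset : f.visited ⊆ f'.visited
  landing_notMem : f'.landing ω g ∉ f.visited

theorem jacobiEnergy_next {ω g : ℝ} {f f' : Flight} (h : IsNextFlight ω g f f') :
    jacobiEnergy ω g f'.pos f'.vel = jacobiEnergy ω g f.pos f.vel +
      ω * g * f.dur * (f.pos.re + (f.posAt g f.dur).re) / 2 := by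
  have h1 := sq_norm_sub_eq_jacobiEnergy ω g f'.pos f'.vel
  have h2 := sq_norm_sub_eq_jacobiEnergy ω g f'.pos (f.velAt g f.dur)
  rw [h.norm_eq] at h1
  rw [← jacobiEnergy_flight, ← h.pos_eq]
  linarith

theorem jacobiEnergy_next_ge {ω g R : ℝ} {f f' : Flight} (hω : 0 < ω) (hg : 0 < g)
    (hf : IsGoodFlight ω g R f) (h : IsNextFlight ω g f f') :
    jacobiEnergy ω g f.pos f.vel + ω * g * f.dur / 2 ≤ jacobiEnergy ω g f'.pos f'.vel := by
  rw [jacobiEnergy_next h]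
  have h1 : 0 < ω * g * f.dur := mul_pos (mul_pos hω hg) hf.dur_pos
  nlinarith [hf.re_pos, hf.re_end]

/-- The reflection dictates the relative speed `κ`. It never falls below `minSpeed`, because the
Jacobi energy only increases; so the construction can go on forever. -/
theorem exists_nextFlight {ω g R : ℝ} (hω : 0 < ω) (hg : 0 < g) (hR1 : 1 ≤ R)
    (hR2 : R ≤ 2) (f : Flight) (hf : IsGoodFlight ω g R f) :
    ∃ f', IsGoodFlight ω g R f' ∧ IsNextFlight ω g f f' := by
  have hκ : minSpeed ω g ≤ ‖f.velAt g f.dur - ω * I * f.posAt g f.dur‖ := by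
    refine le_of_sq_le_sq ?_ (norm_nonneg _)
    rw [sq_norm_sub_eq_jacobiEnergy ω g, jacobiEnergy_flight]
    have h1 : 0 < ω * g * f.dur := mul_pos (mul_pos hω hg) hf.dur_pos
    have h2 : 0 ≤ ω ^ 2 * ‖f.posAt g f.dur‖ ^ 2 := by positivity
    have h3 := (abs_im_le_norm (f.posAt g f.dur)).trans (hf.norm_end.le.trans hR2)
    have h4 := (abs_le.mp h3).2
    nlinarith [hf.re_pos, hf.re_end, hf.jacobi_le]
  have hc : ‖(ω : ℂ) * I * f.posAt g f.dur‖ ≤ 2 * ω := by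
    rw [norm_mul, norm_mul, norm_I, mul_one, norm_real, Real.norm_of_nonneg hω.le, hf.norm_end]
    nlinarith
  obtain ⟨τ, v, q, h1, h2, h3, h4, h5, h6, h7, h8, h9⟩ := exists_flight hω hg hR1 hR2
    hf.norm_end.le hf.abs_im_end hc hκ (f.time + f.dur) f.visited
  classical
  have hnext : IsNextFlight ω g f ⟨f.time + f.dur, f.posAt g f.dur, v, τ,
      insert (exp (-((ω * (f.time + f.dur + τ) : ℝ) : ℂ) * I) * q) f.visited⟩ := by
    refine ⟨rfl, rfl, h4, Finset.subset_insert _ _, ?_⟩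
    simp only [Flight.landing, Flight.posAt] at h3 h9 ⊢
    rw [← h3]
    exact h9
  refine ⟨_, ?_, hnext⟩
  have hJ := jacobiEnergy_next_ge hω hg hf hnext
  have hpos : 0 < ω * g * f.dur := mul_pos (mul_pos hω hg) hf.dur_pos
  have hend : (⟨f.time + f.dur, f.posAt g f.dur, v, τ,
      insert (exp (-((ω * (f.time + f.dur + τ) : ℝ) : ℂ) * I) * q) f.visited⟩ :
      Flight).posAt g τ = q := h3.symm
  refine ⟨h1, h2, hf.norm_end.le, hf.re_end, ?_, ?_, ?_, ?_, ?_, ?_⟩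
  · rw [hend]; exact h5
  · rw [hend]; exact h6
  · rw [hend]; exact h7
  · rw [hend]; exact h8
  · linarith [hf.jacobi_le]
  · rw [Flight.landing, hend]
    exact Finset.mem_insert_self _ _

/-- The initial speed. -/
noncomputable def initialSpeed (ω g : ℝ) : ℝ := minSpeed ω g + 2 * ω + 6 * g + 1

theorem minSpeed_pos {ω g : ℝ} (hω : 0 < ω) (hg : 0 < g) : 0 < minSpeed ω g := by
  have := maxDuration_pos hω hg
  rw [minSpeed]; positivity

theorem exists_initialFlight {ω g R : ℝ} (hω : 0 < ω) (hg : 0 < g) (hR1 : 1 ≤ R)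
    (hR2 : R ≤ 2) :
    ∃ f, IsGoodFlight ω g R f ∧ f.time = 0 ∧ ‖f.pos‖ < 1 ∧ ‖f.vel‖ = initialSpeed ω g := by
  have hm := minSpeed_pos hω hg
  -- Both coordinates have the least absolute value allowed, and the norm `√(1/2)` is less than 1.
  set p : ℂ := ⟨1 / 2, -(1 / 2)⟩
  have hp : ‖p‖ < 1 := by
    refine lt_of_pow_lt_pow_left₀ 2 zero_le_one ?_
    rw [Complex.sq_norm, normSq_apply]
    norm_num [p]
  obtain ⟨τ, v, q, h1, h2, h3, h4, h5, h6, h7, h8, -⟩ := exists_flight (p := p) (c := 0)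
    (κ := initialSpeed ω g) hω hg hR1 hR2
    (hp.le.trans hR1) (by norm_num [p, abs_of_pos]) (by rw [norm_zero]; positivity)
    (by rw [initialSpeed]; linarith) 0 ∅
  rw [sub_zero] at h4
  have hend : ∀ A, (⟨0, p, v, τ, A⟩ : Flight).posAt g τ = q := fun A => h3.symm
  refine ⟨⟨0, p, v, τ, {exp (-((ω * (0 + τ) : ℝ) : ℂ) * I) * q}⟩, ?_, rfl, hp, h4⟩
  refine ⟨h1, h2, hp.le.trans hR1, ?_, ?_, ?_, ?_, ?_, ?_, ?_⟩
  · norm_num [p]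
  · rw [hend]; exact h5
  · rw [hend]; exact h6
  · rw [hend]; exact h7
  · rw [hend]; exact h8
  · have h9 : (conj p * v).im ≤ initialSpeed ω g := by
      refine (le_abs_self _).trans ((abs_im_le_norm _).trans ?_)
      rw [norm_mul, norm_conj, h4]
      have : 0 < initialSpeed ω g := by rw [initialSpeed]; positivity
      nlinarith
    rw [jacobiEnergy, h4]
    have h10 : ω * (conj p * v).im ≤ ω * initialSpeed ω g := mul_le_mul_of_nonneg_left h9 hω.le
    simp only [p]
    -- With `s` the initial speed, the Jacobi energy is at least `s * (s - 2 * ω) / 2 - g / 2`; the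
    -- summands `2 * ω + 6 * g + 1` of `s` make this large enough.
    rw [initialSpeed] at *
    nlinarith
  · rw [Flight.landing, hend]
    exact Finset.mem_singleton_self _

theorem exists_flights {ω g R : ℝ} (hω : 0 < ω) (hg : 0 < g) (hR1 : 1 ≤ R) (hR2 : R ≤ 2) :
    ∃ f : ℕ → Flight, (f 0).time = 0 ∧ ‖(f 0).pos‖ < 1 ∧ ‖(f 0).vel‖ = initialSpeed ω g ∧
      ∀ n, IsGoodFlight ω g R (f n) ∧ IsNextFlight ω g (f n) (f (n + 1)) := by
  obtain ⟨f₀, h₀, h1, h2, h3⟩ := exists_initialFlight hω hg hR1 hR2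
  choose! next hgood hnext using exists_nextFlight hω hg hR1 hR2
  have hall : ∀ n, IsGoodFlight ω g R (next^[n] f₀) := by
    intro n
    induction n with
    | zero => exact h₀
    | succ n ih => rw [Function.iterate_succ_apply']; exact hgood _ ih
  refine ⟨fun n => next^[n] f₀, h1, h2, h3, fun n => ⟨hall n, ?_⟩⟩
  simp only [Function.iterate_succ_apply']
  exact hnext _ (hall n)

/-- With speeds at most `V`, a displacement of at least 1 takes time at least `1 / (V + g)`. Each
flight then adds at least `d` to a Jacobi energy that is bounded in terms of `V`. -/
theorem exists_lt_sq_norm_vel {ω g R : ℝ} (hω : 0 < ω) (hg : 0 < g) (hR2 : R ≤ 2)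
    {f : ℕ → Flight} (hf : ∀ n, IsGoodFlight ω g R (f n) ∧ IsNextFlight ω g (f n) (f (n + 1)))
    (w₁ : ℝ) : ∃ n, w₁ < ‖(f n).vel‖ ^ 2 := by
  by_contra! hcon
  set V := |w₁| + 1
  have hV : 0 < V := by positivity
  have hvel : ∀ n, ‖(f n).vel‖ ≤ V := by
    intro n
    by_contra! h
    nlinarith [hcon n, le_abs_self w₁, abs_nonneg w₁]
  have hdur : ∀ n, 1 / (V + g) ≤ (f n).dur := by
    intro n
    have hG := (hf n).1
    have h1 : (f n).posAt g (f n).dur - (f n).pos =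
        ((f n).vel - (g / 2 : ℝ) * I * (f n).dur) * (f n).dur := by
      rw [Flight.posAt]; ring
    have h2 := hG.dist_le
    rw [h1, norm_mul, norm_real, Real.norm_of_nonneg hG.dur_pos.le] at h2
    have h3 := norm_sub_le (f n).vel ((g / 2 : ℝ) * I * (f n).dur)
    rw [norm_mul, norm_mul, norm_I, norm_real, norm_real, Real.norm_of_nonneg hG.dur_pos.le,
      Real.norm_of_nonneg (by positivity)] at h3
    have h4 : (f n).dur ≤ 1 := by
      have := maxDuration_mul hω hg
      have := maxDuration_pos hω hg
      have := mul_pos hω this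
      have := mul_pos hg (maxDuration_pos hω hg)
      linarith [hG.dur_le]
    rw [div_le_iff₀ (by positivity), mul_comm]
    refine h2.trans (mul_le_mul_of_nonneg_right ?_ hG.dur_pos.le)
    nlinarith [hvel n]
  set d := ω * g * (1 / (V + g)) / 2
  have hd : 0 < d := by positivity
  have hgrow : ∀ n : ℕ, n * d ≤ jacobiEnergy ω g (f n).pos (f n).vel := by
    intro n
    induction n with
    | zero =>
      have h1 := (hf 0).1.jacobi_le
      have h2 : 0 ≤ minSpeed ω g ^ 2 / 2 + 2 * g := by positivity
      simpa using h2.trans h1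
    | succ n ih =>
      have h1 := jacobiEnergy_next_ge hω hg (hf n).1 (hf n).2
      have h2 : ω * g * (1 / (V + g)) ≤ ω * g * (f n).dur :=
        mul_le_mul_of_nonneg_left (hdur n) (by positivity)
      have h3 : d = ω * g * (1 / (V + g)) / 2 := rfl
      push_cast
      linarith
  have hbound : ∀ n, jacobiEnergy ω g (f n).pos (f n).vel ≤ V ^ 2 / 2 + 2 * g + 2 * ω * V := by
    intro n
    have hp := (hf n).1.norm_pos.trans hR2
    have h1 : (f n).pos.im ≤ 2 := (le_abs_self _).trans ((abs_im_le_norm _).trans hp)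
    have h2 : -(conj (f n).pos * (f n).vel).im ≤ 2 * V := by
      refine (neg_le_abs _).trans ((abs_im_le_norm _).trans ?_)
      rw [norm_mul, norm_conj]
      exact mul_le_mul hp (hvel n) (norm_nonneg _) zero_le_two
    have h3 : ‖(f n).vel‖ ^ 2 ≤ V ^ 2 := pow_le_pow_left₀ (norm_nonneg _) (hvel n) 2
    rw [jacobiEnergy]
    nlinarith
  obtain ⟨n, hn⟩ := exists_nat_gt ((V ^ 2 / 2 + 2 * g + 2 * ω * V) / d)
  rw [div_lt_iff₀ hd] at hn
  linarith [hgrow n, hbound n]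

end Flights
-- Flights stay in the disc and meet its boundary transversally
section Trajectories
open Complex ComplexConjugate Filter Topology Set

/-- The parabola is its chord plus a vertical bulge, scaled by the duration to avoid division. -/
theorem Flight.dur_mul_posAt (g : ℝ) (f : Flight) (s : ℝ) :
    (f.dur : ℂ) * f.posAt g s = ((f.dur - s : ℝ) : ℂ) * f.pos + (s : ℂ) * f.posAt g f.dur +
      ((g / 2 * ((f.dur - s) * s * f.dur) : ℝ) : ℂ) * I := by
  simp only [posAt]
  push_cast
  ring

namespace IsGoodFlight

variable {ω g R : ℝ} {f : Flight}

theorem mul_dur_le (hω : 0 < ω) (hg : 0 < g) (hf : IsGoodFlight ω g R f) :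
    f.dur ≤ 1 / 4 ∧ g * f.dur ≤ 1 / 4 := by
  have h1 := maxDuration_mul hω hg
  have h2 := maxDuration_pos hω hg
  have h3 := mul_pos hω h2
  have h4 := mul_pos hg h2
  have h5 := mul_le_mul_of_nonneg_left hf.dur_le hg.le
  constructor <;> linarith [hf.dur_le]

/-- A chord of length at least 1 runs inside the disc with a margin proportional to `s * (dur - s)`.
The bulge has the same factor, with a smaller constant since `g * dur ≤ 1 / 4`. -/
theorem norm_posAt_lt (hω : 0 < ω) (hg : 0 < g) (hR2 : R ≤ 2) (hf : IsGoodFlight ω g R f)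
    {s : ℝ} (hs0 : 0 < s) (hs : s < f.dur) : ‖f.posAt g s‖ < R := by
  obtain ⟨hd1, hd2⟩ := hf.mul_dur_le hω hg
  have hR : 0 ≤ R := (norm_nonneg _).trans hf.norm_pos
  have hdur := hf.dur_pos
  have hmul := f.dur_mul_posAt g s
  set q := f.posAt g f.dur
  set p := f.pos
  set τ := f.dur
  set a := τ - s
  have ha : 0 < a := sub_pos.mpr hs
  have hτ : τ = a + s := by simp [a]
  set y : ℂ := (a : ℂ) * p + (s : ℂ) * q
  -- Stewart's theorem, scaled by the square of the duration.
  have hy : ‖y‖ ^ 2 = τ * (a * ‖p‖ ^ 2 + s * ‖q‖ ^ 2) - a * s * ‖q - p‖ ^ 2 := by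
    rw [hτ]
    simp only [Complex.sq_norm, normSq_apply, y]
    simp
    ring
  have hp2 : ‖p‖ ^ 2 ≤ R ^ 2 := pow_le_pow_left₀ (norm_nonneg _) hf.norm_pos 2
  have hd : 1 ≤ ‖q - p‖ ^ 2 := one_le_pow₀ hf.dist_le
  have has : 0 < a * s := mul_pos ha hs0
  have hy2 : ‖y‖ ^ 2 ≤ (τ * R) ^ 2 - a * s := by
    rw [hy, hf.norm_end]
    have h1 : a * ‖p‖ ^ 2 ≤ a * R ^ 2 := mul_le_mul_of_nonneg_left hp2 ha.le
    have h2 : τ * (a * ‖p‖ ^ 2) ≤ τ * (a * R ^ 2) := mul_le_mul_of_nonneg_left h1 hdur.le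
    have h3 : a * s * 1 ≤ a * s * ‖q - p‖ ^ 2 := mul_le_mul_of_nonneg_left hd has.le
    have h4 : τ * (a * R ^ 2) + τ * (s * R ^ 2) = (τ * R) ^ 2 := by rw [hτ]; ring
    linarith
  have hy1 : ‖y‖ ≤ τ * R := by
    refine le_of_sq_le_sq ?_ (by positivity)
    linarith
  set b := g / 2 * (a * s * τ)
  have hb0 : 0 ≤ b := by positivity
  have hb : b ≤ a * s / 8 := by
    have : b = a * s * (g * τ) / 2 := by simp only [b]; ring
    rw [this]
    nlinarith
  have has1 : a * s ≤ 1 := by nlinarith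
  have hτR : τ * R ≤ 1 / 2 := by nlinarith
  have hnorm : ‖y + (b : ℂ) * I‖ ≤ ‖y‖ + b := by
    refine (norm_add_le _ _).trans_eq ?_
    rw [norm_mul, norm_I, norm_real, Real.norm_of_nonneg hb0, mul_one]
  have hlt : ‖y + (b : ℂ) * I‖ < τ * R := by
    refine lt_of_pow_lt_pow_left₀ 2 (by positivity) ?_
    have h1 : ‖y + (b : ℂ) * I‖ ^ 2 ≤ (‖y‖ + b) ^ 2 := pow_le_pow_left₀ (norm_nonneg _) hnorm 2
    have h2 : ‖y‖ * b ≤ 1 / 2 * (a * s / 8) :=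
      mul_le_mul (hy1.trans hτR) hb hb0 (by norm_num)
    have h3 : b ^ 2 ≤ (a * s) / 64 := by nlinarith
    nlinarith
  rw [← hmul, norm_mul, norm_real, Real.norm_of_nonneg hdur.le] at hlt
  exact lt_of_mul_lt_mul_left hlt hdur.le

/-- For `p`, `q` on the circle, `2⟨q - p, p⟩ = -‖q - p‖² ≤ -1`, while the correction due to gravity
is at most `1 / 8`. The same comparison at the landing point gives `re_velAt_mul_conj_end_pos`. -/
theorem re_vel_mul_conj_pos_neg (hω : 0 < ω) (hg : 0 < g) (hR2 : R ≤ 2)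
    (hf : IsGoodFlight ω g R f) (hp : ‖f.pos‖ = R) : (f.vel * conj f.pos).re < 0 := by
  obtain ⟨hd1, hd2⟩ := hf.mul_dur_le hω hg
  have hdur := hf.dur_pos
  have him : f.pos.im ≤ 2 :=
    (le_abs_self _).trans ((abs_im_le_norm _).trans (hf.norm_pos.trans hR2))
  have hd : 1 ≤ ‖f.posAt g f.dur - f.pos‖ ^ 2 := one_le_pow₀ hf.dist_le
  have hq : ‖f.posAt g f.dur‖ ^ 2 = ‖f.pos‖ ^ 2 := by rw [hf.norm_end, hp]
  have key : 2 * (f.dur * (f.vel * conj f.pos).re) = ‖f.posAt g f.dur‖ ^ 2 - ‖f.pos‖ ^ 2 -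
      ‖f.posAt g f.dur - f.pos‖ ^ 2 + g * f.dur ^ 2 * f.pos.im := by
    simp only [Complex.sq_norm, normSq_apply, sub_re, sub_im, Flight.posAt_re, Flight.posAt_im,
      mul_re, conj_re, conj_im]
    ring
  have h1 : g * f.dur ^ 2 * f.pos.im ≤ 1 / 8 := by
    have h2 : g * f.dur ^ 2 ≤ 1 / 16 := by nlinarith
    have h3 : 0 ≤ g * f.dur ^ 2 := by positivity
    nlinarith
  by_contra! h
  nlinarith [mul_nonneg hdur.le h]

theorem re_velAt_mul_conj_end_pos (hω : 0 < ω) (hg : 0 < g) (hR2 : R ≤ 2)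
    (hf : IsGoodFlight ω g R f) : 0 < (f.velAt g f.dur * conj (f.posAt g f.dur)).re := by
  obtain ⟨hd1, hd2⟩ := hf.mul_dur_le hω hg
  have hdur := hf.dur_pos
  have him : (f.posAt g f.dur).im ≤ 2 :=
    (le_abs_self _).trans ((abs_im_le_norm _).trans (hf.norm_end.le.trans hR2))
  have hd : 1 ≤ ‖f.posAt g f.dur - f.pos‖ ^ 2 := one_le_pow₀ hf.dist_le
  have hq : ‖f.pos‖ ^ 2 ≤ ‖f.posAt g f.dur‖ ^ 2 := by
    rw [hf.norm_end]; exact pow_le_pow_left₀ (norm_nonneg _) hf.norm_pos 2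
  have key : 2 * (f.dur * (f.velAt g f.dur * conj (f.posAt g f.dur)).re) =
      ‖f.posAt g f.dur‖ ^ 2 - ‖f.pos‖ ^ 2 + ‖f.posAt g f.dur - f.pos‖ ^ 2 -
        g * f.dur ^ 2 * (f.posAt g f.dur).im := by
    simp only [Complex.sq_norm, normSq_apply, sub_re, sub_im, Flight.posAt_re, Flight.posAt_im,
      mul_re, conj_re, conj_im, Flight.velAt]
    simp
    ring
  have h1 : g * f.dur ^ 2 * (f.posAt g f.dur).im ≤ 1 / 8 := by
    have h2 : g * f.dur ^ 2 ≤ 1 / 16 := by nlinarith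
    have h3 : 0 ≤ g * f.dur ^ 2 := by positivity
    nlinarith
  by_contra! h
  nlinarith [mul_nonneg hdur.le (neg_nonneg.mpr h)]

end IsGoodFlight

/-! ### Gluing flights into a specular trajectory -/

/-- An infinite sequence of flights, connected by reflections at distinct points of the rotating
table, that starts inside the unit disc at time `0`. -/
structure IsFlightSequence (ω g R : ℝ) (f : ℕ → Flight) : Prop where
  time_zero : (f 0).time = 0
  norm_pos_zero : ‖(f 0).pos‖ < 1
  good : ∀ n, IsGoodFlight ω g R (f n)
  next : ∀ n, IsNextFlight ω g (f n) (f (n + 1))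

/-- The number of the flight that is under way at time `t`, if there are `N + 1` flights. -/
noncomputable def flightIndex (f : ℕ → Flight) (N : ℕ) (t : ℝ) : ℕ :=
  open Classical in Nat.findGreatest (fun k => (f k).time ≤ t) N

/-- The position at time `t` of the particle that makes the first `N + 1` of the flights. -/
noncomputable def flightsPos (g : ℝ) (f : ℕ → Flight) (N : ℕ) (t : ℝ) : ℂ :=
  (f (flightIndex f N t)).posAt g (t - (f (flightIndex f N t)).time)

/-- The velocity at time `t` of the particle that makes the first `N + 1` of the flights. -/
noncomputable def flightsVel (g : ℝ) (f : ℕ → Flight) (N : ℕ) (t : ℝ) : ℂ :=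
  (f (flightIndex f N t)).velAt g (t - (f (flightIndex f N t)).time)

theorem Flight.hasDerivAt_posAt (g : ℝ) (f : Flight) (t₀ t : ℝ) :
    HasDerivAt (fun t : ℝ => f.posAt g (t - t₀)) (f.velAt g (t - t₀)) t := by
  have h1 : HasDerivAt (fun t : ℝ => ((t - t₀ : ℝ) : ℂ)) 1 t := by
    simpa using ((hasDerivAt_id t).sub_const t₀).ofReal_comp
  refine (((h1.const_mul f.vel).const_add f.pos).sub
    ((h1.pow 2).const_mul (((g / 2 : ℝ) : ℂ) * I))).congr_deriv ?_
  rw [velAt]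
  push_cast
  ring

theorem Flight.hasDerivAt_velAt (g : ℝ) (f : Flight) (t₀ t : ℝ) :
    HasDerivAt (fun t : ℝ => f.velAt g (t - t₀)) (-(g : ℂ) * I) t := by
  have h1 : HasDerivAt (fun t : ℝ => ((t - t₀ : ℝ) : ℂ)) 1 t := by
    simpa using ((hasDerivAt_id t).sub_const t₀).ofReal_comp
  refine ((h1.const_mul ((g : ℂ) * I)).const_sub f.vel).congr_deriv ?_
  ring

theorem hasDerivWithinAt_rotatingPosition {ω t : ℝ} {x : ℝ → ℂ} {v : ℂ} {A : Set ℝ}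
    (h : HasDerivWithinAt x v A t) :
    HasDerivWithinAt (rotatingPosition ω x)
      (exp (-((ω * t : ℝ) : ℂ) * I) * (v - (ω : ℂ) * I * x t)) A t := by
  have h1 : HasDerivAt (fun t : ℝ => ((ω * t : ℝ) : ℂ)) (ω : ℂ) t := by
    simpa using ((hasDerivAt_id t).const_mul ω).ofReal_comp
  have h2 := ((h1.neg.mul_const I).cexp).hasDerivWithinAt (s := A) |>.mul h
  refine h2.congr_deriv ?_
  simp only [Pi.neg_apply]
  ring

theorem norm_exp_neg_mul_I (a : ℝ) : ‖exp (-(a : ℂ) * I)‖ = 1 := by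
  rw [← ofReal_neg]; exact norm_exp_ofReal_mul_I _

theorem norm_rotatingPosition (ω : ℝ) (x : ℝ → ℂ) (t : ℝ) :
    ‖rotatingPosition ω x t‖ = ‖x t‖ := by
  rw [rotatingPosition, norm_mul, norm_exp_neg_mul_I, one_mul]

/-- The velocity `ω * I * y` of the table is orthogonal to `y`, so the radial velocity is the same
in both frames. -/
theorem re_rotating_mul_conj (a ω : ℝ) (y v : ℂ) :
    (exp (-(a : ℂ) * I) * (v - (ω : ℂ) * I * y) * conj (exp (-(a : ℂ) * I) * y)).re =
      (v * conj y).re := by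
  have h : exp (-(a : ℂ) * I) * conj (exp (-(a : ℂ) * I)) = 1 := by
    rw [mul_conj, normSq_eq_norm_sq, norm_exp_neg_mul_I]; simp
  have : exp (-(a : ℂ) * I) * (v - (ω : ℂ) * I * y) * conj (exp (-(a : ℂ) * I) * y) =
      (v - (ω : ℂ) * I * y) * conj y := by
    rw [map_mul]
    linear_combination (v - (ω : ℂ) * I * y) * conj y * h
  rw [this]
  simp
  ring

namespace IsFlightSequence

variable {ω g R : ℝ} {f : ℕ → Flight} {N k : ℕ} {t : ℝ}

theorem time_succ (hf : IsFlightSequence ω g R f) (n : ℕ) :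
    (f (n + 1)).time = (f n).time + (f n).dur := (hf.next n).time_eq

theorem strictMono_time (hf : IsFlightSequence ω g R f) : StrictMono fun n => (f n).time :=
  strictMono_nat_of_lt_succ fun n => by
    rw [hf.time_succ]; linarith [(hf.good n).dur_pos]

theorem flightIndex_eq (hf : IsFlightSequence ω g R f) (hk : k ≤ N)
    (ht : t ∈ Ico (f k).time (f (k + 1)).time) : flightIndex f N t = k := by
  classical
  rw [flightIndex, Nat.findGreatest_eq_iff]
  refine ⟨hk, fun _ => ht.1, fun n hn _ => not_le.mpr (ht.2.trans_le ?_)⟩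
  exact hf.strictMono_time.monotone hn

theorem exists_mem_Ico (hf : IsFlightSequence ω g R f) (ht0 : 0 ≤ t)
    (ht : t < (f (N + 1)).time) : ∃ k ≤ N, t ∈ Ico (f k).time (f (k + 1)).time := by
  induction N with
  | zero => exact ⟨0, le_rfl, hf.time_zero.le.trans ht0, ht⟩
  | succ n ih =>
    rcases lt_or_ge t (f (n + 1)).time with h | h
    · obtain ⟨k, hk, hkt⟩ := ih h
      exact ⟨k, hk.trans n.le_succ, hkt⟩
    · exact ⟨n + 1, le_rfl, h, ht⟩

theorem flightsPos_eq (hf : IsFlightSequence ω g R f) (hk : k ≤ N)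
    (ht : t ∈ Ico (f k).time (f (k + 1)).time) :
    flightsPos g f N t = (f k).posAt g (t - (f k).time) := by
  rw [flightsPos, hf.flightIndex_eq hk ht]

theorem flightsVel_eq (hf : IsFlightSequence ω g R f) (hk : k ≤ N)
    (ht : t ∈ Ico (f k).time (f (k + 1)).time) :
    flightsVel g f N t = (f k).velAt g (t - (f k).time) := by
  rw [flightsVel, hf.flightIndex_eq hk ht]

theorem time_mem_Ico (hf : IsFlightSequence ω g R f) (k : ℕ) :
    (f k).time ∈ Ico (f k).time (f (k + 1)).time :=
  ⟨le_rfl, hf.strictMono_time k.lt_succ_self⟩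

theorem flightsPos_time (hf : IsFlightSequence ω g R f) (hk : k ≤ N) :
    flightsPos g f N (f k).time = (f k).pos := by
  rw [hf.flightsPos_eq hk (hf.time_mem_Ico k), sub_self, Flight.posAt]; simp

theorem flightsVel_time (hf : IsFlightSequence ω g R f) (hk : k ≤ N) :
    flightsVel g f N (f k).time = (f k).vel := by
  rw [hf.flightsVel_eq hk (hf.time_mem_Ico k), sub_self, Flight.velAt]; simp

theorem right_flight (hf : IsFlightSequence ω g R f) (hk : k ≤ N)
    (ht : t ∈ Ico (f k).time (f (k + 1)).time) :
    HasDerivWithinAt (flightsPos g f N) (flightsVel g f N t) (Ici t) t ∧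
      HasDerivWithinAt (flightsVel g f N) (-(g : ℂ) * I) (Ici t) t := by
  have hnhds : ∀ᶠ r in 𝓝[≥] t, r ∈ Ico (f k).time (f (k + 1)).time := by
    filter_upwards [Ico_mem_nhdsGE ht.2] with r hr using ⟨ht.1.trans hr.1, hr.2⟩
  constructor
  · rw [hf.flightsVel_eq hk ht]
    refine ((f k).hasDerivAt_posAt g _ t).hasDerivWithinAt.congr_of_eventuallyEq ?_
      (hf.flightsPos_eq hk ht)
    filter_upwards [hnhds] with r hr using hf.flightsPos_eq hk hr
  · refine ((f k).hasDerivAt_velAt g _ t).hasDerivWithinAt.congr_of_eventuallyEq ?_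
      (hf.flightsVel_eq hk ht)
    filter_upwards [hnhds] with r hr using hf.flightsVel_eq hk hr

theorem free_flight (hf : IsFlightSequence ω g R f) (hk : k ≤ N)
    (ht : t ∈ Ioo (f k).time (f (k + 1)).time) :
    HasDerivAt (flightsPos g f N) (flightsVel g f N t) t ∧
      HasDerivAt (flightsVel g f N) (-(g : ℂ) * I) t := by
  have hnhds : ∀ᶠ r in 𝓝 t, r ∈ Ico (f k).time (f (k + 1)).time := Ico_mem_nhds ht.1 ht.2
  constructor
  · rw [hf.flightsVel_eq hk (Ioo_subset_Ico_self ht)]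
    refine ((f k).hasDerivAt_posAt g _ t).congr_of_eventuallyEq ?_
    filter_upwards [hnhds] with r hr using hf.flightsPos_eq hk hr
  · refine ((f k).hasDerivAt_velAt g (f k).time t).congr_of_eventuallyEq ?_
    filter_upwards [hnhds] with r hr using hf.flightsVel_eq hk hr

theorem left_flight (hf : IsFlightSequence ω g R f) (hk : k + 1 ≤ N) :
    HasDerivWithinAt (flightsPos g f N) ((f k).velAt g (f k).dur) (Iic (f (k + 1)).time)
        (f (k + 1)).time ∧
      Tendsto (flightsVel g f N) (𝓝[<] (f (k + 1)).time) (𝓝 ((f k).velAt g (f k).dur)) := by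
  have hlt : (f k).time < (f (k + 1)).time := hf.strictMono_time k.lt_succ_self
  have hdur : (f (k + 1)).time - (f k).time = (f k).dur := by rw [hf.time_succ]; ring
  have hpos : flightsPos g f N (f (k + 1)).time =
      (f k).posAt g ((f (k + 1)).time - (f k).time) := by
    rw [hf.flightsPos_time hk, hdur, (hf.next k).pos_eq]
  constructor
  · have h1 := (f k).hasDerivAt_posAt g (f k).time (f (k + 1)).time
    rw [hdur] at h1
    refine h1.hasDerivWithinAt.congr_of_eventuallyEq ?_ hpos
    filter_upwards [Ioc_mem_nhdsLE hlt] with r hr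
    rcases hr.2.eq_or_lt with rfl | h
    · exact hpos
    · exact hf.flightsPos_eq (k.le_succ.trans hk) ⟨hr.1.le, h⟩
  · have h1 := ((f k).hasDerivAt_velAt g (f k).time (f (k + 1)).time).continuousAt.tendsto
    rw [hdur] at h1
    refine (h1.mono_left nhdsWithin_le_nhds).congr' ?_
    filter_upwards [Ioo_mem_nhdsLT hlt] with r hr
    exact (hf.flightsVel_eq (k.le_succ.trans hk) ⟨hr.1.le, hr.2⟩).symm

/-- The sets `visited` increase and contain each landing point, while every new landing avoids the
preceding set. Distinct landing points let each mirror be tilted independently. -/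
theorem landing_ne (hf : IsFlightSequence ω g R f) {j k : ℕ} (hjk : j < k) :
    (f j).landing ω g ≠ (f k).landing ω g := by
  have hmono : Monotone fun n => (f n).visited :=
    monotone_nat_of_le_succ fun n => (hf.next n).visited_subset
  obtain ⟨k, rfl⟩ := Nat.exists_eq_add_of_lt hjk
  intro h
  refine (hf.next (j + k)).landing_notMem ?_
  rw [← h]
  exact hmono (Nat.le_add_right j k) (hf.good j).landing_mem

theorem rotatingPosition_time (hf : IsFlightSequence ω g R f) (hk : k + 1 ≤ N) :
    rotatingPosition ω (flightsPos g f N) (f (k + 1)).time = (f k).landing ω g := by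
  rw [rotatingPosition, hf.flightsPos_time hk, Flight.landing, hf.time_succ, (hf.next k).pos_eq]

/-- The times of the first `N` reflections. -/
noncomputable def _root_.reflectionTimes (f : ℕ → Flight) (N : ℕ) : Finset ℝ :=
  (Finset.range N).image fun k => (f (k + 1)).time

theorem _root_.mem_reflectionTimes {f : ℕ → Flight} :
    t ∈ reflectionTimes f N ↔ ∃ k, k + 1 ≤ N ∧ (f (k + 1)).time = t := by
  simp [reflectionTimes]

theorem mem_Ioo_of_notMem (hf : IsFlightSequence ω g R f) (hk : k ≤ N) (ht0 : 0 < t)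
    (ht : t ∈ Ico (f k).time (f (k + 1)).time) (htS : t ∉ reflectionTimes f N) :
    t ∈ Ioo (f k).time (f (k + 1)).time := by
  refine ⟨lt_of_le_of_ne ht.1 ?_, ht.2⟩
  rintro rfl
  cases k with
  | zero => exact ht0.ne' hf.time_zero
  | succ k => exact htS (mem_reflectionTimes.mpr ⟨k, hk, rfl⟩)

theorem continuousOn_flightsPos (hf : IsFlightSequence ω g R f) :
    ContinuousOn (flightsPos g f N) (Ico 0 (f (N + 1)).time) := by
  intro t ht
  obtain ⟨k, hk, hkt⟩ := hf.exists_mem_Ico ht.1 ht.2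
  have hright := (hf.right_flight hk hkt).1.continuousWithinAt
  rcases ht.1.eq_or_lt with rfl | ht0
  · exact hright.mono fun r hr => hr.1
  refine ContinuousAt.continuousWithinAt ?_
  by_cases htS : t ∈ reflectionTimes f N
  · obtain ⟨j, hj, rfl⟩ := mem_reflectionTimes.mp htS
    exact continuousAt_iff_continuous_left_right.mpr
      ⟨(hf.left_flight hj).1.continuousWithinAt, hright⟩
  · exact (hf.free_flight hk (hf.mem_Ioo_of_notMem hk ht0 hkt htS)).1.continuousAt

theorem norm_flightsPos_lt (hω : 0 < ω) (hg : 0 < g) (hR1 : 1 < R) (hR2 : R ≤ 2)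
    (hf : IsFlightSequence ω g R f) (ht0 : 0 ≤ t) (ht : t < (f (N + 1)).time)
    (htS : t ∉ reflectionTimes f N) : ‖flightsPos g f N t‖ < R := by
  obtain ⟨k, hk, hkt⟩ := hf.exists_mem_Ico ht0 ht
  rcases ht0.eq_or_lt with rfl | ht0
  · have h := hf.flightsPos_time (N := N) (Nat.zero_le N)
    rw [hf.time_zero] at h
    rw [h]
    exact hf.norm_pos_zero.trans hR1
  · have h := hf.mem_Ioo_of_notMem hk ht0 hkt htS
    rw [hf.flightsPos_eq hk hkt]
    refine (hf.good k).norm_posAt_lt hω hg hR2 (sub_pos.mpr h.1) ?_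
    have := h.2
    rw [hf.time_succ] at this
    linarith

/-- At a reflection, the velocity in the rotating frame turns from outward to inward and keeps its
length. -/
theorem exists_incoming_velocity (hω : 0 < ω) (hg : 0 < g) (hR2 : R ≤ 2)
    (hf : IsFlightSequence ω g R f) (ht : t ∈ reflectionTimes f N) :
    ∃ u : ℂ, Tendsto (rotatingVelocity ω (flightsPos g f N) (flightsVel g f N)) (𝓝[<] t) (𝓝 u) ∧
      HasDerivWithinAt (rotatingPosition ω (flightsPos g f N)) u (Iic t) t ∧
      ‖u‖ = ‖rotatingVelocity ω (flightsPos g f N) (flightsVel g f N) t‖ ∧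
      0 < (u * conj (rotatingPosition ω (flightsPos g f N) t)).re ∧
      (rotatingVelocity ω (flightsPos g f N) (flightsVel g f N) t *
        conj (rotatingPosition ω (flightsPos g f N) t)).re < 0 := by
  obtain ⟨k, hk, rfl⟩ := mem_reflectionTimes.mp ht
  obtain ⟨hl1, hl2⟩ := hf.left_flight hk
  have hpos := hf.flightsPos_time hk
  have hvel := hf.flightsVel_time hk
  have hposk := (hf.next k).pos_eq
  have hd := hasDerivWithinAt_rotatingPosition (ω := ω) hl1
  refine ⟨_, ?_, hd, ?_, ?_, ?_⟩
  · have h1 : Tendsto (flightsPos g f N) (𝓝[<] (f (k + 1)).time)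
        (𝓝 (flightsPos g f N (f (k + 1)).time)) :=
      hl1.continuousWithinAt.tendsto.mono_left (nhdsWithin_mono _ Iio_subset_Iic_self)
    have h2 : Continuous fun r : ℝ => exp (-((ω * r : ℝ) : ℂ) * I) := by fun_prop
    exact ((h2.tendsto _).mono_left nhdsWithin_le_nhds).mul (hl2.sub (h1.const_mul _))
  · rw [rotatingVelocity, norm_mul, norm_mul, hpos, hvel, (hf.next k).norm_eq]
  · rw [rotatingPosition, re_rotating_mul_conj, hpos, hposk]
    exact (hf.good k).re_velAt_mul_conj_end_pos hω hg hR2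
  · rw [rotatingPosition, rotatingVelocity, re_rotating_mul_conj, hpos, hvel]
    refine (hf.good (k + 1)).re_vel_mul_conj_pos_neg hω hg hR2 ?_
    rw [hposk, (hf.good k).norm_end]

theorem exists_specularTrajectory {ε : ℝ} (hω : 0 < ω) (hg : 0 < g) (hR1 : 1 < R)
    (hR2 : R ≤ 2) (hRε : R < 1 + ε) (hf : IsFlightSequence ω g R f) (N : ℕ) :
    ∃ (D : Set ℂ) (γ : ℝ → ℂ), IsSmoothBilliardTable D γ ∧ Metric.closedBall 0 1 ⊆ D ∧
      frontier D ⊆ {z : ℂ | 1 < ‖z‖ ∧ ‖z‖ < 1 + ε} ∧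
      ∃ T, (f N).time ∈ Ico 0 T ∧ IsSpecularTrajectory ω g D γ T (reflectionTimes f N)
        (flightsPos g f N) (flightsVel g f N) := by
  -- Stopping in the middle of flight `N` includes exactly the first `N` reflections and excludes
  -- the landing of that flight.
  obtain ⟨T, hT1, hT2⟩ := exists_between (hf.strictMono_time N.lt_succ_self)
  have htime : ∀ {i j : ℕ}, i ≤ j → (f i).time ≤ (f j).time :=
    fun h => hf.strictMono_time.monotone h
  have hN0 : 0 ≤ (f N).time := hf.time_zero ▸ htime N.zero_le
  have hS : ∀ t ∈ reflectionTimes f N, t ∈ Ioo 0 T := by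
    intro t ht
    obtain ⟨k, hk, rfl⟩ := mem_reflectionTimes.mp ht
    refine ⟨?_, (htime hk).trans_lt hT1⟩
    have := hf.strictMono_time k.succ_pos
    simpa only [hf.time_zero] using this
  choose! u hu using fun t ht => hf.exists_incoming_velocity (N := N) (t := t) hω hg hR2 ht
  have hcontT : ContinuousOn (flightsPos g f N) (Icc 0 T) :=
    hf.continuousOn_flightsPos.mono fun t ht => ⟨ht.1, ht.2.trans_lt hT2⟩
  have hpiece : ∀ t ∈ Ico 0 T, ∃ k ≤ N, t ∈ Ico (f k).time (f (k + 1)).time := fun t ht =>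
    hf.exists_mem_Ico ht.1 (ht.2.trans hT2)
  obtain ⟨D, γ, h1, h2, h3, h4, h5⟩ := exists_table hR1 hRε (reflectionTimes f N)
    (rotatingPosition ω (flightsPos g f N)) u
    (rotatingVelocity ω (flightsPos g f N) (flightsVel g f N)) (T := T)
    (by
      have h : Continuous fun r : ℝ => exp (-((ω * r : ℝ) : ℂ) * I) := by fun_prop
      exact h.continuousOn.mul hcontT)
    hS
    (fun t ht htS => by
      rw [norm_rotatingPosition]
      exact hf.norm_flightsPos_lt hω hg hR1 hR2 ht.1 (ht.2.trans_lt hT2) htS)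
    (fun t ht => by
      obtain ⟨k, hk, rfl⟩ := mem_reflectionTimes.mp ht
      rw [norm_rotatingPosition, hf.flightsPos_time hk, (hf.next k).pos_eq, (hf.good k).norm_end])
    (fun a ha b hb hab => by
      obtain ⟨i, hi, rfl⟩ := mem_reflectionTimes.mp ha
      obtain ⟨j, hj, rfl⟩ := mem_reflectionTimes.mp hb
      rw [hf.rotatingPosition_time hi, hf.rotatingPosition_time hj] at hab
      rcases lt_trichotomy i j with h | rfl | h
      · exact absurd hab (hf.landing_ne h)
      · rfl
      · exact absurd hab.symm (hf.landing_ne h))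
    (fun t ht => (hu t ht).2.1)
    (fun t ht => by
      obtain ⟨k, hk, hkt⟩ := hpiece t (Ioo_subset_Ico_self (hS t ht))
      exact hasDerivWithinAt_rotatingPosition (hf.right_flight hk hkt).1)
    (fun t ht => (hu t ht).2.2.1) (fun t ht => (hu t ht).2.2.2.1)
    (fun t ht => (hu t ht).2.2.2.2)
  refine ⟨D, γ, h1, h2, h3, T, ⟨hN0, hT1⟩, ?_⟩
  exact {
    reflection_times := hS
    continuousOn := hcontT.mono Ico_subset_Icc_self
    mem_table := fun t ht htS => h4 t (Ioo_subset_Icc_self ht) htS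
    free_flight := fun t ht htS => by
      obtain ⟨k, hk, hkt⟩ := hpiece t (Ioo_subset_Ico_self ht)
      exact hf.free_flight hk (hf.mem_Ioo_of_notMem hk ht.1 hkt htS)
    right_flight := fun t ht => by
      obtain ⟨k, hk, hkt⟩ := hpiece t ht
      exact hf.right_flight hk hkt
    specular := fun t ht => by
      obtain ⟨θ, hθ, hw⟩ := h5 t ht
      exact ⟨θ, hθ, u t, (hu t ht).1, hw⟩ }

end IsFlightSequence

end Trajectories

/-! ### The main theorem -/

theorem mainTheorem11 (ω g : ℝ) (hω : 0 < ω) (hg : 0 < g) :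
    ∃ w₀ : ℝ, ∀ w₁ ε : ℝ, 0 < ε →
      ∃ (D : Set ℂ) (γ : ℝ → ℂ), IsSmoothBilliardTable D γ ∧
        Metric.closedBall 0 1 ⊆ D ∧
        frontier D ⊆ {z : ℂ | 1 < ‖z‖ ∧ ‖z‖ < 1 + ε} ∧
        ∃ (T : ℝ) (S : Finset ℝ) (x v : ℝ → ℂ),
          IsSpecularTrajectory ω g D γ T S x v ∧
          ‖v 0‖ ^ 2 = w₀ ∧
          ∃ t ∈ Set.Ico 0 T, w₁ < ‖v t‖ ^ 2 := by
  refine ⟨initialSpeed ω g ^ 2, fun w₁ ε hε => ?_⟩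
  -- Only `R` depends on `ε`; the bound `R < 2` makes the estimates for the flights uniform.
  obtain ⟨R, hR1, hR⟩ := exists_between (lt_min one_lt_two (lt_add_of_pos_right 1 hε))
  obtain ⟨hR2, hRε⟩ := lt_min_iff.mp hR
  obtain ⟨f, h0, h1, h2, h3⟩ := exists_flights hω hg hR1.le hR2.le
  have hf : IsFlightSequence ω g R f := ⟨h0, h1, fun n => (h3 n).1, fun n => (h3 n).2⟩
  obtain ⟨N, hN⟩ := exists_lt_sq_norm_vel hω hg hR2.le h3 w₁
  obtain ⟨D, γ, hD, hball, hfr, T, hT, htraj⟩ :=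
    hf.exists_specularTrajectory hω hg hR1 hR2.le hRε N
  refine ⟨D, γ, hD, hball, hfr, T, _, _, _, htraj, ?_, (f N).time, hT, ?_⟩
  · have h := hf.flightsVel_time (N := N) N.zero_le
    rw [h0] at h
    rw [h, h2]
  · rwa [hf.flightsVel_time le_rfl]
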